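/- The claw number of a finite graph $G$ is the largest $w \ge 0$ such that $G$ contains the star $K_{1,w}$ as an induced subgraph (and $0$ if $G$ has no vertices). An interval graph is the intersection graph of a finite family of open intervals of the real line. For a fixed integer $v \ge 1$, let Min-Partition$(v)$ be the problem of finding a vertex partition of a given graph into the minimum number of induced subgraphs with claw number at most $v$. Theorem. For every fixed integer $v \ge 1$, Min-Partition$(v)$ in interval graphs admits a polynomial-time approximation algorithm, with ratio $3$ if $1 \le v \le 2$ and with ratio $2$ if $v \ge 3$. That is, with $t = 3$ if $v \le 2$ and $t = 2$ if $v \ge 3$, there is an algorithm (a random access machine with unit-cost addition, subtraction, memory access and tests) which, given the adjacency matrix of any interval graph $G$ with $n$ vertices, halts after a number of steps bounded by a polynomial in $n$ and outputs a vertex partition of $G$ into at most $t \cdot \kappa(G,v)$ induced subgraphs with claw number at most $v$, where $\kappa(G,v)$ is the smallest number of induced subgraphs with claw number at most $v$ into which the vertices of $G$ can be partitioned. -/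

import Mathlib

/-! ### Interval graphs -/

/-- `G` is an interval graph: the intersection graph of a family `(l x, r x)`, `x : V`,
of (nonempty) open intervals of the real line, one interval for each vertex. -/
def IsIntervalGraph {V : Type*} (G : SimpleGraph V) : Prop :=
  ∃ l r : V → ℝ, (∀ x, l x < r x) ∧
    ∀ x y, G.Adj x y ↔ x ≠ y ∧ (Set.Ioo (l x) (r x) ∩ Set.Ioo (l y) (r y)).Nonempty

/-! ### Claw numbers and the optimization problem -/

/-- The star `K_{1,w}`. -/
abbrev star1 (w : ℕ) : SimpleGraph (Fin 1 ⊕ Fin w) := completeBipartiteGraph (Fin 1) (Fin w)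

/-- The claw number of a finite graph `G`: the largest `w` such that `G` contains the star
`K_{1,w}` as an induced subgraph. (It is `0` for the graph without vertices.) -/
noncomputable def clawNumber {V : Type*} [Finite V] (G : SimpleGraph V) : ℕ :=
  sSup {w : ℕ | (star1 w).IsIndContained G}

/-- The feasible solutions of Min-Partition(`v`) on `G`. A vertex partition is given by a
labelling `c` of the vertices, its parts being the nonempty classes of equal labels; every
part has to induce a subgraph with claw number at most `v`. -/
def IsClawPartition {V : Type*} [Finite V] (G : SimpleGraph V) (v : ℕ) (c : V → ℕ) : Prop :=
  ∀ a : ℕ, clawNumber (G.induce {x | c x = a}) ≤ v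

/-- The number of parts of the partition given by the labelling `c`. -/
def numParts {V : Type*} [Fintype V] (c : V → ℕ) : ℕ := (Finset.univ.image c).card

/-- `κ(G, v)`: the minimum number of parts of a vertex partition of `G` into induced
subgraphs with claw number at most `v`, i.e. the optimum of Min-Partition(`v`) on `G`. -/
noncomputable def minParts {V : Type*} [Fintype V] (G : SimpleGraph V) (v : ℕ) : ℕ :=
  sInf {k : ℕ | ∃ c : V → ℕ, IsClawPartition G v c ∧ numParts c = k}

/-! ### Random access machines with a step count -/

namespace RAM

/-- The state of the machine: registers and a memory, all cells holding natural numbers. -/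
structure State where
  /-- the contents of the registers -/
  reg : ℕ → ℕ
  /-- the contents of the memory, by address -/
  mem : ℕ → ℕ

/-- Structured programs; `x`, `y`, `z` are (fixed) names of registers. There is no
multiplication, so that numbers grow by at most one bit in a step and unit cost is
polynomially related to the running time of Turing machines. -/
inductive Prog where
  /-- `x := k` -/
  | const (x k : ℕ)
  /-- `x := y + z` -/
  | add (x y z : ℕ)
  /-- `x := max (y - z) 0` -/
  | sub (x y z : ℕ)
  /-- `x := mem[y]` -/
  | load (x y : ℕ)
  /-- `mem[x] := y` -/
  | store (x y : ℕ)
  /-- `p; q` -/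
  | seq (p q : Prog)
  /-- `if x ≠ 0 then p else q` -/
  | ite (x : ℕ) (p q : Prog)
  /-- `while x ≠ 0 do p` -/
  | loop (x : ℕ) (p : Prog)

/-- Assignment to a register. -/
def State.setReg (s : State) (x a : ℕ) : State := { s with reg := Function.update s.reg x a }

/-- Assignment to a memory cell. -/
def State.setMem (s : State) (i a : ℕ) : State := { s with mem := Function.update s.mem i a }

/-- `Exec p s s' t`: started in state `s`, the program `p` halts in state `s'` after exactly
`t` steps. Every elementary instruction and every test costs one step. -/
inductive Exec : Prog → State → State → ℕ → Prop where
  | const (s : State) (x k : ℕ) : Exec (.const x k) s (s.setReg x k) 1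
  | add (s : State) (x y z : ℕ) : Exec (.add x y z) s (s.setReg x (s.reg y + s.reg z)) 1
  | sub (s : State) (x y z : ℕ) : Exec (.sub x y z) s (s.setReg x (s.reg y - s.reg z)) 1
  | load (s : State) (x y : ℕ) : Exec (.load x y) s (s.setReg x (s.mem (s.reg y))) 1
  | store (s : State) (x y : ℕ) : Exec (.store x y) s (s.setMem (s.reg x) (s.reg y)) 1
  | seq {p q : Prog} {s s₁ s₂ : State} {t₁ t₂ : ℕ} :
      Exec p s s₁ t₁ → Exec q s₁ s₂ t₂ → Exec (.seq p q) s s₂ (t₁ + t₂)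
  | ite_true {x : ℕ} {p q : Prog} {s s' : State} {t : ℕ} :
      s.reg x ≠ 0 → Exec p s s' t → Exec (.ite x p q) s s' (t + 1)
  | ite_false {x : ℕ} {p q : Prog} {s s' : State} {t : ℕ} :
      s.reg x = 0 → Exec q s s' t → Exec (.ite x p q) s s' (t + 1)
  | loop_true {x : ℕ} {p : Prog} {s s₁ s₂ : State} {t₁ t₂ : ℕ} :
      s.reg x ≠ 0 → Exec p s s₁ t₁ → Exec (.loop x p) s₁ s₂ t₂ →
        Exec (.loop x p) s s₂ (t₁ + t₂ + 1)
  | loop_false {x : ℕ} {p : Prog} {s : State} :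
      s.reg x = 0 → Exec (.loop x p) s s 1

open Classical in
/-- The initial state for the input graph `G` on the vertices `0, …, n - 1`: register `0`
holds `n`, the memory cells `0, …, n * n - 1` hold the adjacency matrix of `G` row by row, and
all other registers and cells hold `0`. -/
noncomputable def input {n : ℕ} (G : SimpleGraph (Fin n)) : State where
  reg x := if x = 0 then n else 0
  mem a := if ∃ i j : Fin n, a = n * i + j ∧ G.Adj i j then 1 else 0

/-- The labelling of `n` vertices that a halting state represents: an array of length `n`
stored directly after the adjacency matrix. -/
def output (n : ℕ) (s : State) : Fin n → ℕ := fun i => s.mem (n * n + i)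

end RAM

/-! ### Approximation algorithms -/

/-- The program `p` is a polynomial-time approximation algorithm with ratio `ρ` for
Min-Partition(`v`) in interval graphs: on every interval graph with `n` vertices, given by its
adjacency matrix, it halts within a number of steps polynomial in `n` and outputs a vertex
partition into induced subgraphs with claw number at most `v` whose number of parts is at most
`ρ` times the minimum. -/
def IsPolyTimeApprox (v ρ : ℕ) (p : RAM.Prog) : Prop :=
  ∃ P : Polynomial ℕ, ∀ (n : ℕ) (G : SimpleGraph (Fin n)), IsIntervalGraph G →
    ∃ (s : RAM.State) (t : ℕ), RAM.Exec p (RAM.input G) s t ∧ t ≤ P.eval n ∧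
      IsClawPartition G v (RAM.output n s) ∧
      numParts (RAM.output n s) ≤ ρ * minParts G v

/-!
Say that a vertex `z` dominates `w` if the closed neighbourhood of `z` contains that of `w`. In an
interval graph the centre of a claw dominates all leaves but the first and the last one
(`IsRep.exists_dominated_leaves`). The algorithm works with neighbourhoods only and never
constructs an interval representation.

The level of a vertex is at least `k + 1` if the vertex dominates `v + 1` pairwise nonadjacent
vertices of level at least `k`. In every feasible partition, of any graph, the vertices dominated
by a vertex of level `k` lie in at least `k + 1` parts (`level_lt_card`): if this holds for `k` and
a vertex `z` of level `k + 1` dominated vertices of only `k + 1` parts, then each of the `v + 1`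
vertices that give `z` its level would dominate a vertex of each of these parts, in particular of
the part of `z`, and these vertices would form a claw with centre `z` in that part. So the
optimum exceeds the largest level, and it suffices to partition each level into `ρ` feasible
parts.

Within a level every vertex dominates at most `v` pairwise nonadjacent vertices. For `v ≥ 3` two
parts suffice, the vertices that dominate `v - 1` such vertices and the others
(`isClawPartition_two`). For three parts, let a breadth-first search start from a simplicial vertex
in each component of the level. One part are the vertices dominated by a neighbour in the preceding
layer, and the others are split by the parity of the layer (`isClawPartition_three`). The reason is
that on one side of the root the intervals of earlier layers start before those of later
ones (`IsLayering.left_le`), so that a neighbour in the preceding layer of the last leaf of a claw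
contains all other leaves.

All of this is expressible by formulas with quantifiers over the vertices and by loops of length
`n`. Such formulas and loops form a small language with a compiler to the random access machine;
the running time of a compiled program is bounded by a polynomial obtained by recursion on the
source (`RAM.Term.compile_spec`, `RAM.Cmd.compile_spec`). The quantifiers for `v + 1` nonadjacent
vertices are nested, which is polynomial because `v` is fixed.
-/

/-! ### A small language of bounded computations and its compilation -/

namespace RAM

/-- Expressions over natural numbers: the input size, variables, literals, sums, truncated
differences, memory access, conditionals (a nonzero value is true), and sums in which the
variable `i` runs through all numbers below the input size. The last also serves as a bounded
existential quantifier. -/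
inductive Term where
  | size
  | var (i : ℕ)
  | lit (k : ℕ)
  | add (a b : Term)
  | sub (a b : Term)
  | load (a : Term)
  | ite (c a b : Term)
  | sum (i : ℕ) (a : Term)

/-- The value of an expression for the input size `n`, the memory `m` and the values `ρ` of the
variables. -/
def Term.eval (n : ℕ) (m : ℕ → ℕ) : Term → (ℕ → ℕ) → ℕ
  | .size, _ => n
  | .var i, ρ => ρ i
  | .lit k, _ => k
  | .add a b, ρ => a.eval n m ρ + b.eval n m ρ
  | .sub a b, ρ => a.eval n m ρ - b.eval n m ρ
  | .load a, ρ => m (a.eval n m ρ)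
  | .ite c a b, ρ => if c.eval n m ρ ≠ 0 then a.eval n m ρ else b.eval n m ρ
  | .sum i a, ρ => ∑ x ∈ Finset.range n, a.eval n m (Function.update ρ i x)

/-- Commands: assignment to a memory cell, composition, and a loop in which the variable `i`
runs upwards through all numbers below the input size. -/
inductive Cmd where
  | store (a b : Term)
  | seq (c d : Cmd)
  | each (i : ℕ) (c : Cmd)

/-- The memory after the execution of a command. -/
def Cmd.run (n : ℕ) : Cmd → (ℕ → ℕ) → (ℕ → ℕ) → ℕ → ℕ
  | .store a b, ρ, m => Function.update m (a.eval n m ρ) (b.eval n m ρ)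
  | .seq c d, ρ, m => d.run n ρ (c.run n ρ m)
  | .each i c, ρ, m => Nat.rec m (fun k m' => c.run n (Function.update ρ i k) m') n

/-- `x := y`, for different registers `x` and `y`. -/
def Prog.move (x y : ℕ) : Prog := .seq (.const x 0) (.add x x y)

/-- The program that computes the value of an expression in register `2 * d + 1`. Register `0`
holds the input size, register `2 * i + 2` holds the variable `i`, and the registers
`2 * j + 1` with `j ≥ d` are free for intermediate results. A sum saves and restores its bound
variable. -/
def Term.compile : Term → ℕ → Prog
  | .size, d => .move (2 * d + 1) 0
  | .var i, d => .move (2 * d + 1) (2 * i + 2)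
  | .lit k, d => .const (2 * d + 1) k
  | .add a b, d =>
      .seq (a.compile d) (.seq (b.compile (d + 1)) (.add (2 * d + 1) (2 * d + 1) (2 * d + 3)))
  | .sub a b, d =>
      .seq (a.compile d) (.seq (b.compile (d + 1)) (.sub (2 * d + 1) (2 * d + 1) (2 * d + 3)))
  | .load a, d => .seq (a.compile d) (.load (2 * d + 1) (2 * d + 1))
  | .ite c a b, d => .seq (c.compile d) (.ite (2 * d + 1) (a.compile d) (b.compile d))
  | .sum i a, d =>
      .seq (.const (2 * d + 1) 0) <| .seq (.move (2 * d + 3) (2 * i + 2)) <|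
      .seq (.move (2 * i + 2) 0) <| .seq (.const (2 * d + 5) 1) <|
      .seq (.loop (2 * i + 2) (.seq (.sub (2 * i + 2) (2 * i + 2) (2 * d + 5))
        (.seq (a.compile (d + 3)) (.add (2 * d + 1) (2 * d + 1) (2 * d + 7))))) <|
      .move (2 * i + 2) (2 * d + 3)

/-- The program for a command, with the same use of registers as for expressions. -/
def Cmd.compile : Cmd → ℕ → Prog
  | .store a b, d =>
      .seq (a.compile d) (.seq (b.compile (d + 1)) (.store (2 * d + 1) (2 * d + 3)))
  | .seq c e, d => .seq (c.compile d) (e.compile d)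
  | .each i c, d =>
      .seq (.move (2 * d + 1) (2 * i + 2)) <| .seq (.move (2 * d + 3) 0) <|
      .seq (.const (2 * d + 5) 1) <| .seq (.const (2 * i + 2) 0) <|
      .seq (.loop (2 * d + 3) (.seq (c.compile (d + 3))
        (.seq (.add (2 * i + 2) (2 * i + 2) (2 * d + 5))
          (.sub (2 * d + 3) (2 * d + 3) (2 * d + 5))))) <|
      .move (2 * i + 2) (2 * d + 1)

/-- `p` leads from `s` to `s'` in at most `T` steps. -/
def Runs (p : Prog) (s s' : State) (T : ℕ) : Prop := ∃ t ≤ T, Exec p s s' t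

theorem Runs.seq {p q : Prog} {s s₁ s₂ : State} {T₁ T₂ : ℕ} (hp : Runs p s s₁ T₁)
    (hq : Runs q s₁ s₂ T₂) : Runs (.seq p q) s s₂ (T₁ + T₂) := by
  obtain ⟨t₁, h₁, e₁⟩ := hp
  obtain ⟨t₂, h₂, e₂⟩ := hq
  exact ⟨_, add_le_add h₁ h₂, e₁.seq e₂⟩

theorem Runs.mono {p : Prog} {s s' : State} {T T' : ℕ} (hp : Runs p s s' T) (h : T ≤ T') :
    Runs p s s' T' :=
  let ⟨t, ht, e⟩ := hp
  ⟨t, ht.trans h, e⟩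

theorem runs_const (s : State) (x k : ℕ) : Runs (.const x k) s (s.setReg x k) 1 :=
  ⟨1, le_rfl, .const s x k⟩

theorem runs_add (s : State) (x y z : ℕ) :
    Runs (.add x y z) s (s.setReg x (s.reg y + s.reg z)) 1 := ⟨1, le_rfl, .add s x y z⟩

theorem runs_sub (s : State) (x y z : ℕ) :
    Runs (.sub x y z) s (s.setReg x (s.reg y - s.reg z)) 1 := ⟨1, le_rfl, .sub s x y z⟩

theorem runs_load (s : State) (x y : ℕ) :
    Runs (.load x y) s (s.setReg x (s.mem (s.reg y))) 1 := ⟨1, le_rfl, .load s x y⟩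

theorem runs_store (s : State) (x y : ℕ) :
    Runs (.store x y) s (s.setMem (s.reg x) (s.reg y)) 1 := ⟨1, le_rfl, .store s x y⟩

@[simp]
theorem setReg_reg (s : State) (x a y : ℕ) :
    (s.setReg x a).reg y = if y = x then a else s.reg y := by
  simp [State.setReg, Function.update_apply]

@[simp]
theorem setReg_mem (s : State) (x a : ℕ) : (s.setReg x a).mem = s.mem := rfl

theorem runs_move (s : State) {x y : ℕ} (h : y ≠ x) :
    Runs (.move x y) s (s.setReg x (s.reg y)) 2 := by
  have h1 := (runs_const s x 0).seq (runs_add (s.setReg x 0) x x y)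
  have : (s.setReg x 0).setReg x ((s.setReg x 0).reg x + (s.setReg x 0).reg y)
      = s.setReg x (s.reg y) := by
    simp [h, State.setReg]
  rwa [this] at h1

/-- The values of the variables in a state. -/
def State.env (s : State) : ℕ → ℕ := fun i => s.reg (2 * i + 2)

/-- The states `s` and `s'` agree on the input size, the variables and the first `d`
intermediate results. -/
def Agree (d : ℕ) (s s' : State) : Prop :=
  ∀ r, r % 2 = 0 ∨ r < 2 * d + 1 → s'.reg r = s.reg r

theorem Agree.env {d : ℕ} {s s' : State} (h : Agree d s s') : s'.env = s.env := by
  funext i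
  exact h _ (Or.inl (by omega))

theorem Agree.zero {d : ℕ} {s s' : State} (h : Agree d s s') : s'.reg 0 = s.reg 0 :=
  h _ (Or.inl rfl)

/-- The time bound of a compiled expression depends on the input size only, so that it can be
used for all iterations of a loop. -/
theorem Term.compile_spec (a : Term) : ∃ P : Polynomial ℕ, ∀ (d : ℕ) (s : State),
    ∃ s' : State, Runs (a.compile d) s s' (P.eval (s.reg 0)) ∧ Agree d s s' ∧
      s'.mem = s.mem ∧ s'.reg (2 * d + 1) = a.eval (s.reg 0) s.mem s.env := by
  induction a with
  | size =>
    refine ⟨2, fun d s => ⟨s.setReg (2 * d + 1) (s.reg 0), ?_, ?_, rfl, by simp [eval]⟩⟩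
    · have h := runs_move s (x := 2 * d + 1) (y := 0) (by omega)
      simpa [Term.compile] using h
    · intro r hr
      rw [setReg_reg, if_neg (by omega)]
  | var i =>
    refine ⟨2, fun d s => ⟨s.setReg (2 * d + 1) (s.reg (2 * i + 2)), ?_, ?_, rfl,
      by simp [eval, State.env]⟩⟩
    · have h := runs_move s (x := 2 * d + 1) (y := 2 * i + 2) (by omega)
      simpa [Term.compile] using h
    · intro r hr
      rw [setReg_reg, if_neg (by omega)]
  | lit k =>
    refine ⟨1, fun d s => ⟨s.setReg (2 * d + 1) k, ?_, ?_, rfl, by simp [eval]⟩⟩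
    · have h := runs_const s (2 * d + 1) k
      simpa [Term.compile] using h
    · intro r hr
      rw [setReg_reg, if_neg (by omega)]
  | add a b iha ihb =>
    obtain ⟨P, hP⟩ := iha
    obtain ⟨Q, hQ⟩ := ihb
    refine ⟨P + Q + 1, fun d s => ?_⟩
    obtain ⟨s₁, r₁, g₁, m₁, v₁⟩ := hP d s
    obtain ⟨s₂, r₂, g₂, m₂, v₂⟩ := hQ (d + 1) s₁
    refine ⟨_, (r₁.seq (r₂.seq (runs_add _ _ _ _))).mono ?_, ?_, by simp [m₁, m₂], ?_⟩
    · simp [g₁.zero]; omega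
    · intro r hr
      rw [setReg_reg, if_neg (by omega), g₂ r (by omega), g₁ r hr]
    · have := g₂ (2 * d + 1) (Or.inr (by omega))
      simp only [setReg_reg, if_true, this, v₁, eval]
      rw [show 2 * d + 3 = 2 * (d + 1) + 1 by omega, v₂, m₁, g₁.zero, g₁.env]
  | sub a b iha ihb =>
    obtain ⟨P, hP⟩ := iha
    obtain ⟨Q, hQ⟩ := ihb
    refine ⟨P + Q + 1, fun d s => ?_⟩
    obtain ⟨s₁, r₁, g₁, m₁, v₁⟩ := hP d s
    obtain ⟨s₂, r₂, g₂, m₂, v₂⟩ := hQ (d + 1) s₁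
    refine ⟨_, (r₁.seq (r₂.seq (runs_sub _ _ _ _))).mono ?_, ?_, by simp [m₁, m₂], ?_⟩
    · simp [g₁.zero]; omega
    · intro r hr
      rw [setReg_reg, if_neg (by omega), g₂ r (by omega), g₁ r hr]
    · have := g₂ (2 * d + 1) (Or.inr (by omega))
      simp only [setReg_reg, if_true, this, v₁, eval]
      rw [show 2 * d + 3 = 2 * (d + 1) + 1 by omega, v₂, m₁, g₁.zero, g₁.env]
  | load a iha =>
    obtain ⟨P, hP⟩ := iha
    refine ⟨P + 1, fun d s => ?_⟩
    obtain ⟨s₁, r₁, g₁, m₁, v₁⟩ := hP d s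
    refine ⟨_, (r₁.seq (runs_load _ _ _)).mono (by simp), ?_, by simp [m₁], ?_⟩
    · intro r hr
      rw [setReg_reg, if_neg (by omega), g₁ r hr]
    · simp [eval, v₁, m₁]
  | ite c a b ihc iha ihb =>
    obtain ⟨R, hR⟩ := ihc
    obtain ⟨P, hP⟩ := iha
    obtain ⟨Q, hQ⟩ := ihb
    refine ⟨R + (P + Q + 1), fun d s => ?_⟩
    obtain ⟨s₁, r₁, g₁, m₁, v₁⟩ := hR d s
    by_cases hc : c.eval (s.reg 0) s.mem s.env ≠ 0
    · obtain ⟨s₂, ⟨t₂, ht₂, e₂⟩, g₂, m₂, v₂⟩ := hP d s₁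
      have r₂ : Runs (.ite (2 * d + 1) (a.compile d) (b.compile d)) s₁ s₂ (t₂ + 1) :=
        ⟨_, le_rfl, .ite_true (by rwa [v₁]) e₂⟩
      refine ⟨s₂, (r₁.seq r₂).mono ?_, fun r hr => (g₂ r hr).trans (g₁ r hr), m₂.trans m₁, ?_⟩
      · rw [g₁.zero] at ht₂
        simp; omega
      · rw [v₂, eval, if_pos hc, m₁, g₁.zero, g₁.env]
    · obtain ⟨s₂, ⟨t₂, ht₂, e₂⟩, g₂, m₂, v₂⟩ := hQ d s₁
      have r₂ : Runs (.ite (2 * d + 1) (a.compile d) (b.compile d)) s₁ s₂ (t₂ + 1) :=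
        ⟨_, le_rfl, .ite_false (by rw [v₁]; simpa using hc) e₂⟩
      refine ⟨s₂, (r₁.seq r₂).mono ?_, fun r hr => (g₂ r hr).trans (g₁ r hr), m₂.trans m₁, ?_⟩
      · rw [g₁.zero] at ht₂
        simp; omega
      · rw [v₂, eval, if_neg hc, m₁, g₁.zero, g₁.env]
  | sum i a iha =>
    obtain ⟨P, hP⟩ := iha
    refine ⟨Polynomial.X * (P + 3) + 10, fun d s => ?_⟩
    -- The loop counts the bound variable down from `k`.
    have loop : ∀ (k : ℕ) (s : State), s.reg (2 * i + 2) = k → s.reg (2 * d + 5) = 1 →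
        ∃ s' : State, Runs (.loop (2 * i + 2) (.seq (.sub (2 * i + 2) (2 * i + 2) (2 * d + 5))
          (.seq (a.compile (d + 3)) (.add (2 * d + 1) (2 * d + 1) (2 * d + 7))))) s s'
            (k * (P.eval (s.reg 0) + 3) + 1) ∧
          (∀ r, r ≠ 2 * i + 2 → r ≠ 2 * d + 1 → r % 2 = 0 ∨ r < 2 * d + 7 →
            s'.reg r = s.reg r) ∧ s'.mem = s.mem ∧
          s'.reg (2 * d + 1) = s.reg (2 * d + 1) +
            ∑ x ∈ Finset.range k, a.eval (s.reg 0) s.mem (Function.update s.env i x) := by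
      intro k
      induction k with
      | zero =>
        intro s h0 _
        exact ⟨s, ⟨1, by simp, .loop_false h0⟩, fun _ _ _ _ => rfl, rfl, by simp⟩
      | succ k ih =>
        intro s hk h1
        obtain ⟨s₂, r₂, g₂, m₂, v₂⟩ := hP (d + 3) (s.setReg (2 * i + 2) k)
        have r₁ := runs_sub s (2 * i + 2) (2 * i + 2) (2 * d + 5)
        rw [hk, h1, Nat.add_sub_cancel] at r₁
        have r₃ := runs_add s₂ (2 * d + 1) (2 * d + 1) (2 * d + 7)
        set s₃ := s₂.setReg (2 * d + 1) (s₂.reg (2 * d + 1) + s₂.reg (2 * d + 7)) with hs₃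
        have g₃ : ∀ r, r ≠ 2 * d + 1 → r % 2 = 0 ∨ r < 2 * d + 7 →
            s₃.reg r = if r = 2 * i + 2 then k else s.reg r := by
          intro r h h'
          rw [hs₃, setReg_reg, if_neg h, g₂ r (by omega), setReg_reg]
        obtain ⟨s₄, ⟨t₄, ht₄, e₄⟩, g₄, m₄, v₄⟩ := ih s₃
          (by rw [g₃ _ (by omega) (by omega), if_pos rfl])
          (by rw [g₃ _ (by omega) (by omega), if_neg (by omega), h1])
        have h0 : s₃.reg 0 = s.reg 0 := by
          rw [g₃ _ (by omega) (by omega), if_neg (by omega)]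
        have hm : s₃.mem = s.mem := by rw [hs₃, setReg_mem, m₂, setReg_mem]
        have he : ∀ x, Function.update s₃.env i x = Function.update s.env i x := by
          intro x
          funext j
          rcases eq_or_ne j i with rfl | hj
          · simp
          · simp only [Function.update_of_ne hj, State.env]
            rw [g₃ _ (by omega) (by omega), if_neg (by omega)]
        have he' : (s.setReg (2 * i + 2) k).env = Function.update s.env i k := by
          funext j
          rcases eq_or_ne j i with rfl | hj
          · simp [State.env]
          · simp only [Function.update_of_ne hj, State.env]
            rw [setReg_reg, if_neg (by omega)]
        obtain ⟨t₁, ht₁, e₁⟩ := r₁.seq (r₂.seq r₃)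
        refine ⟨s₄, ⟨_, ?_, .loop_true (by omega) e₁ e₄⟩, ?_, m₄.trans hm, ?_⟩
        · rw [h0] at ht₄
          rw [setReg_reg, if_neg (by omega)] at ht₁
          rw [Nat.succ_mul]
          omega
        · intro r h h' h''
          rw [g₄ r h h' h'', g₃ r h' h'', if_neg h]
        · rw [v₄, Finset.sum_range_succ, h0, hm]
          simp only [he]
          rw [hs₃, setReg_reg, if_pos rfl, g₂ _ (by omega), setReg_reg, if_neg (by omega),
            show 2 * d + 7 = 2 * (d + 3) + 1 by omega, v₂, he']
          simp only [setReg_reg, setReg_mem]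
          rw [if_neg (by omega)]
          ring
    have r₁ := runs_const s (2 * d + 1) 0
    set s₁ := s.setReg (2 * d + 1) 0 with hs₁
    have r₂ := runs_move s₁ (x := 2 * d + 3) (y := 2 * i + 2) (by omega)
    set s₂ := s₁.setReg (2 * d + 3) (s₁.reg (2 * i + 2)) with hs₂
    have r₃ := runs_move s₂ (x := 2 * i + 2) (y := 0) (by omega)
    set s₃ := s₂.setReg (2 * i + 2) (s₂.reg 0) with hs₃
    have r₄ := runs_const s₃ (2 * d + 5) 1
    set s₄ := s₃.setReg (2 * d + 5) 1 with hs₄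
    have g₄ : ∀ r, s₄.reg r = if r = 2 * d + 5 then 1 else if r = 2 * i + 2 then s.reg 0 else
        if r = 2 * d + 3 then s.reg (2 * i + 2) else if r = 2 * d + 1 then 0 else s.reg r := by
      intro r
      rw [hs₄, hs₃, hs₂, hs₁]
      simp only [setReg_reg]
      rw [if_neg (show 0 ≠ 2 * d + 3 by omega), if_neg (show 0 ≠ 2 * d + 1 by omega),
        if_neg (show 2 * i + 2 ≠ 2 * d + 1 by omega)]
    obtain ⟨s₅, r₅, g₅, m₅, v₅⟩ := loop (s.reg 0) s₄
      (by rw [g₄, if_neg (by omega), if_pos rfl]) (by rw [g₄, if_pos rfl])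
    have r₆ := runs_move s₅ (x := 2 * i + 2) (y := 2 * d + 3) (by omega)
    have h0 : s₄.reg 0 = s.reg 0 := by
      rw [g₄, if_neg (by omega), if_neg (by omega), if_neg (by omega), if_neg (by omega)]
    refine ⟨_, (r₁.seq (r₂.seq (r₃.seq (r₄.seq (r₅.seq r₆))))).mono ?_, ?_, ?_, ?_⟩
    · rw [h0]
      simp
      omega
    · intro r hr
      rw [setReg_reg]
      split_ifs with h
      · rw [g₅ _ (by omega) (by omega) (by omega), g₄, if_neg (by omega), if_neg (by omega),
          if_pos rfl, h]
      · rw [g₅ _ h (by omega) (by omega), g₄, if_neg (by omega), if_neg h, if_neg (by omega),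
          if_neg (by omega)]
    · rw [setReg_mem, m₅]
      rfl
    · rw [setReg_reg, if_neg (by omega), v₅, h0, g₄, if_neg (by omega), if_neg (by omega),
        if_neg (by omega), if_pos rfl, zero_add, eval]
      refine Finset.sum_congr rfl fun x _ => ?_
      congr 1
      funext j
      rcases eq_or_ne j i with rfl | hj
      · simp
      · simp only [Function.update_of_ne hj, State.env]
        rw [g₄, if_neg (by omega), if_neg (by omega), if_neg (by omega), if_neg (by omega)]

theorem Cmd.compile_spec (c : Cmd) : ∃ P : Polynomial ℕ, ∀ (d : ℕ) (s : State),
    ∃ s' : State, Runs (c.compile d) s s' (P.eval (s.reg 0)) ∧ Agree d s s' ∧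
      s'.mem = c.run (s.reg 0) s.env s.mem := by
  induction c with
  | store a b =>
    obtain ⟨P, hP⟩ := a.compile_spec
    obtain ⟨Q, hQ⟩ := b.compile_spec
    refine ⟨P + Q + 1, fun d s => ?_⟩
    obtain ⟨s₁, r₁, g₁, m₁, v₁⟩ := hP d s
    obtain ⟨s₂, r₂, g₂, m₂, v₂⟩ := hQ (d + 1) s₁
    refine ⟨_, (r₁.seq (r₂.seq (runs_store _ _ _))).mono ?_, ?_, ?_⟩
    · simp [g₁.zero]; omega
    · intro r hr
      exact (g₂ r (by omega)).trans (g₁ r hr)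
    · have := g₂ (2 * d + 1) (Or.inr (by omega))
      simp only [State.setMem, run]
      rw [this, v₁, show 2 * d + 3 = 2 * (d + 1) + 1 by omega, v₂, m₂, m₁, g₁.zero, g₁.env]
  | seq c e ihc ihe =>
    obtain ⟨P, hP⟩ := ihc
    obtain ⟨Q, hQ⟩ := ihe
    refine ⟨P + Q, fun d s => ?_⟩
    obtain ⟨s₁, r₁, g₁, m₁⟩ := hP d s
    obtain ⟨s₂, r₂, g₂, m₂⟩ := hQ d s₁
    refine ⟨s₂, (r₁.seq r₂).mono ?_, fun r hr => (g₂ r hr).trans (g₁ r hr), ?_⟩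
    · simp [g₁.zero]
    · rw [m₂, m₁, g₁.zero, g₁.env, run]
  | each i c ih =>
    obtain ⟨P, hP⟩ := ih
    refine ⟨Polynomial.X * (P + 3) + 10, fun d s => ?_⟩
    have loop : ∀ (k j : ℕ) (s : State), s.reg (2 * d + 3) = k → s.reg (2 * i + 2) = j →
        s.reg (2 * d + 5) = 1 →
        ∃ s' : State, Runs (.loop (2 * d + 3) (.seq (c.compile (d + 3))
          (.seq (.add (2 * i + 2) (2 * i + 2) (2 * d + 5))
          (.sub (2 * d + 3) (2 * d + 3) (2 * d + 5))))) s s'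
            (k * (P.eval (s.reg 0) + 3) + 1) ∧
          (∀ r, r ≠ 2 * i + 2 → r ≠ 2 * d + 3 → r % 2 = 0 ∨ r < 2 * d + 7 →
            s'.reg r = s.reg r) ∧
          ∀ f : ℕ → ℕ → ℕ, f j = s.mem →
            (∀ l, f (l + 1) = c.run (s.reg 0) (Function.update s.env i l) (f l)) →
            s'.mem = f (j + k) := by
      intro k
      induction k with
      | zero =>
        intro j s h0 _ _
        exact ⟨s, ⟨1, by simp, .loop_false h0⟩, fun _ _ _ _ => rfl, fun f hf _ => by simp [hf]⟩
      | succ k ih =>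
        intro j s hk hj h1
        obtain ⟨s₁, r₁, g₁, m₁⟩ := hP (d + 3) s
        have r₂ := runs_add s₁ (2 * i + 2) (2 * i + 2) (2 * d + 5)
        set s₂ := s₁.setReg (2 * i + 2) (s₁.reg (2 * i + 2) + s₁.reg (2 * d + 5)) with hs₂
        have r₃ := runs_sub s₂ (2 * d + 3) (2 * d + 3) (2 * d + 5)
        set s₃ := s₂.setReg (2 * d + 3) (s₂.reg (2 * d + 3) - s₂.reg (2 * d + 5)) with hs₃
        have g₃ : ∀ r, r % 2 = 0 ∨ r < 2 * d + 7 →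
            s₃.reg r = if r = 2 * d + 3 then k else if r = 2 * i + 2 then j + 1
              else s.reg r := by
          intro r h
          rw [hs₃, hs₂]
          simp only [setReg_reg]
          rw [if_neg (show 2 * d + 3 ≠ 2 * i + 2 by omega),
            if_neg (show 2 * d + 5 ≠ 2 * i + 2 by omega), g₁ _ (by omega), g₁ _ (by omega),
            g₁ _ (by omega), g₁ _ (by omega), hk, hj, h1, Nat.add_sub_cancel]
        obtain ⟨s₄, ⟨t₄, ht₄, e₄⟩, g₄, m₄⟩ := ih (j + 1) s₃
          (by rw [g₃ _ (by omega), if_pos rfl])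
          (by rw [g₃ _ (by omega), if_neg (by omega), if_pos rfl])
          (by rw [g₃ _ (by omega), if_neg (by omega), if_neg (by omega), h1])
        have h0 : s₃.reg 0 = s.reg 0 := by
          rw [g₃ _ (by omega), if_neg (by omega), if_neg (by omega)]
        have he : ∀ x, Function.update s₃.env i x = Function.update s.env i x := by
          intro x
          funext j
          rcases eq_or_ne j i with rfl | hj
          · simp
          · simp only [Function.update_of_ne hj, State.env]
            rw [g₃ _ (by omega), if_neg (by omega), if_neg (by omega)]
        have he' : Function.update s.env i j = s.env := by
          rw [Function.update_eq_self_iff, State.env, hj]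
        obtain ⟨t₁, ht₁, e₁⟩ := r₁.seq (r₂.seq r₃)
        refine ⟨s₄, ⟨_, ?_, .loop_true (by omega) e₁ e₄⟩, ?_, ?_⟩
        · rw [h0] at ht₄
          rw [Nat.succ_mul]
          omega
        · intro r h h' h''
          rw [g₄ r h h' h'', g₃ r h'', if_neg h', if_neg h]
        · intro f hf hf'
          rw [m₄ f ?_ ?_]
          · congr 1
            omega
          · rw [hf', hf, he', hs₃, hs₂, setReg_mem, setReg_mem, m₁]
          · intro l
            rw [hf', h0, he]
    have r₁ := runs_move s (x := 2 * d + 1) (y := 2 * i + 2) (by omega)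
    set s₁ := s.setReg (2 * d + 1) (s.reg (2 * i + 2)) with hs₁
    have r₂ := runs_move s₁ (x := 2 * d + 3) (y := 0) (by omega)
    set s₂ := s₁.setReg (2 * d + 3) (s₁.reg 0) with hs₂
    have r₃ := runs_const s₂ (2 * d + 5) 1
    set s₃ := s₂.setReg (2 * d + 5) 1 with hs₃
    have r₄ := runs_const s₃ (2 * i + 2) 0
    set s₄ := s₃.setReg (2 * i + 2) 0 with hs₄
    have g₄ : ∀ r, s₄.reg r = if r = 2 * i + 2 then 0 else if r = 2 * d + 5 then 1 else
        if r = 2 * d + 3 then s.reg 0 else if r = 2 * d + 1 then s.reg (2 * i + 2)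
        else s.reg r := by
      intro r
      rw [hs₄, hs₃, hs₂, hs₁]
      simp only [setReg_reg]
      rw [if_neg (show 0 ≠ 2 * d + 1 by omega)]
    obtain ⟨s₅, r₅, g₅, m₅⟩ := loop (s.reg 0) 0 s₄
      (by rw [g₄, if_neg (by omega), if_neg (by omega), if_pos rfl])
      (by rw [g₄, if_pos rfl]) (by rw [g₄, if_neg (by omega), if_pos rfl])
    have r₆ := runs_move s₅ (x := 2 * i + 2) (y := 2 * d + 1) (by omega)
    have h0 : s₄.reg 0 = s.reg 0 := by
      rw [g₄, if_neg (by omega), if_neg (by omega), if_neg (by omega), if_neg (by omega)]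
    refine ⟨_, (r₁.seq (r₂.seq (r₃.seq (r₄.seq (r₅.seq r₆))))).mono ?_, ?_, ?_⟩
    · rw [h0]
      simp
      omega
    · intro r hr
      rw [setReg_reg]
      split_ifs with h
      · rw [g₅ _ (by omega) (by omega) (by omega), g₄, if_neg (by omega), if_neg (by omega),
          if_neg (by omega), if_pos rfl, h]
      · rw [g₅ _ h (by omega) (by omega), g₄, if_neg h, if_neg (by omega), if_neg (by omega),
          if_neg (by omega)]
    · rw [setReg_mem, run,
        m₅ (fun l => Nat.rec s.mem (fun k m' => c.run (s.reg 0) (Function.update s.env i k) m') l)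
          rfl ?_, zero_add]
      intro l
      have he : Function.update s₄.env i l = Function.update s.env i l := by
        funext j
        rcases eq_or_ne j i with rfl | hj
        · simp
        · simp only [Function.update_of_ne hj, State.env]
          rw [g₄, if_neg (by omega), if_neg (by omega), if_neg (by omega), if_neg (by omega)]
      rw [h0, he]

end RAM

/-! ### Neighbourhood inclusion and levels -/

section Levels

variable {V : Type*} (G : SimpleGraph V)

/-- The vertex `z` dominates the vertex `w`: the closed neighbourhood of `w` is contained in
that of `z`. -/
def Dominates (z w : V) : Prop := ∀ u, u = w ∨ G.Adj w u → u = z ∨ G.Adj z u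

/-- The vertex `z` dominates `k` pairwise nonadjacent vertices whose label `f` is at least that
of `z`. -/
def Packs (f : V → ℕ) (z : V) (k : ℕ) : Prop :=
  ∃ W : Finset V, W.card = k ∧ (∀ w ∈ W, f z ≤ f w ∧ Dominates G z w) ∧
    ∀ w ∈ W, ∀ w' ∈ W, ¬ G.Adj w w'

open Classical in
/-- The level of a vertex after `k` rounds: in round `k` the level of a vertex is raised from
`k` to `k + 1` if the vertex dominates `v + 1` pairwise nonadjacent vertices of level at least
`k`. -/
noncomputable def level (v : ℕ) : ℕ → V → ℕ
  | 0, _ => 0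
  | k + 1, z => if level v k z = k ∧ Packs G (level v k) z (v + 1) then k + 1 else level v k z

variable {G}

theorem Dominates.refl (z : V) : Dominates G z z := by
  rintro u (h | h)
  · exact Or.inl h
  · exact Or.inr h

theorem Dominates.trans {x y z : V} (h : Dominates G z y) (h' : Dominates G y x) :
    Dominates G z x := by
  intro u hu
  rcases h' u hu with h1 | h1
  · exact h u (Or.inl h1)
  · exact h u (Or.inr h1)

theorem Dominates.adj {z w : V} (h : Dominates G z w) (hne : w ≠ z) : G.Adj z w :=
  (h w (Or.inl rfl)).resolve_left hne

/-- Vertices dominated by two different nonadjacent vertices are different and nonadjacent. -/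
theorem Dominates.not_adj {w w' u u' : V} (hne : w ≠ w') (h : ¬ G.Adj w w')
    (hu : Dominates G w u) (hu' : Dominates G w' u') : u ≠ u' ∧ ¬ G.Adj u u' := by
  have key : ¬ (u' = u ∨ G.Adj u u') := by
    intro h1
    have h2 : u' = w ∨ G.Adj w u' := hu u' h1
    have h3 : w = w' ∨ G.Adj w' w := by
      apply hu' w
      rcases h2 with h2 | h2
      · exact Or.inl h2.symm
      · exact Or.inr h2.symm
    rcases h3 with h3 | h3
    · exact hne h3
    · exact h h3.symm
  exact ⟨fun h1 => key (Or.inl h1.symm), fun h1 => key (Or.inr h1)⟩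

theorem Packs.mono {f : V → ℕ} {z : V} {k : ℕ} {W : Finset V} (hk : k ≤ W.card)
    (h1 : ∀ w ∈ W, f z ≤ f w ∧ Dominates G z w) (h2 : ∀ w ∈ W, ∀ w' ∈ W, ¬ G.Adj w w') :
    Packs G f z k := by
  obtain ⟨U, hU, hc⟩ := Finset.exists_subset_card_eq hk
  exact ⟨U, hc, fun w hw => h1 w (hU hw), fun w hw w' hw' => h2 w (hU hw) w' (hU hw')⟩

theorem level_le (v k : ℕ) (z : V) : level G v k z ≤ k := by
  induction k with
  | zero => simp [level]
  | succ k ih =>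
    rw [level]
    split_ifs
    · exact le_rfl
    · omega

theorem min_level (v k j : ℕ) (z : V) : min (level G v (k + j) z) k = level G v k z := by
  induction j with
  | zero => simpa using level_le v k z
  | succ j ih =>
    rw [← add_assoc, level]
    split_ifs with h
    · rw [← ih, h.1]
      omega
    · exact ih

/-- A vertex whose level is not maximal packs at most `v` vertices of at least its level. -/
theorem not_packs_level {v n : ℕ} {z : V} (hz : level G v n z < n) :
    ¬ Packs G (level G v n) z (v + 1) := by
  rintro ⟨W, hc, h1, h2⟩
  obtain ⟨k, hk⟩ : ∃ k, k = level G v n z := ⟨_, rfl⟩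
  rw [← hk] at hz
  obtain ⟨j, rfl⟩ := Nat.exists_eq_add_of_lt hz
  have hz1 := min_level v k (j + 1) z (G := G)
  have hz2 := min_level v (k + 1) j z (G := G)
  rw [← add_assoc] at hz1
  rw [show k + 1 + j = k + j + 1 by omega] at hz2
  have hk' : level G v (k + j + 1) z = k := hk.symm
  rw [hk'] at hz1 hz2 h1
  have hz3 : level G v k z = k := by omega
  have hp : Packs G (level G v k) z (v + 1) := by
    refine ⟨W, hc, fun w hw => ⟨?_, (h1 w hw).2⟩, h2⟩
    have := min_level v k (j + 1) w (G := G)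
    rw [← add_assoc] at this
    have := (h1 w hw).1
    omega
  rw [level, if_pos ⟨hz3, hp⟩] at hz2
  omega

/-! ### Claw numbers and packings -/

variable [Fintype V]

/-- In a graph with claw number at most `v`, no vertex has `v + 1` pairwise nonadjacent
neighbours. -/
theorem card_le_of_clawNumber_le {X : Set V} {v : ℕ} (hX : clawNumber (G.induce X) ≤ v) {z : V}
    (hz : z ∈ X) {W : Finset V} (hW : ∀ w ∈ W, w ∈ X ∧ G.Adj z w)
    (hW' : ∀ w ∈ W, ∀ w' ∈ W, ¬ G.Adj w w') : W.card ≤ v := by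
  refine le_trans (le_csSup ⟨Nat.card X, ?_⟩ ?_) hX
  · rintro k ⟨e⟩
    have := Nat.card_le_card_of_injective e e.injective
    rw [Nat.card_eq_fintype_card, Fintype.card_sum, Fintype.card_fin, Fintype.card_fin] at this
    omega
  · let e : Fin W.card ≃ W := W.equivFin.symm
    refine ⟨⟨⟨Sum.elim (fun _ => ⟨z, hz⟩) fun i => ⟨e i, (hW _ (e i).2).1⟩, ?_⟩, ?_⟩⟩
    · rintro (i | i) (j | j) h
      · exact congrArg _ (Subsingleton.elim _ _)
      · have h' : z = e j := congrArg Subtype.val h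
        exact absurd h' (hW _ (e j).2).2.ne
      · have h' : (e i : V) = z := congrArg Subtype.val h
        exact absurd h'.symm (hW _ (e i).2).2.ne
      · have h' : (e i : V) = e j := congrArg (fun x : X => (x : V)) h
        rw [e.injective (Subtype.ext h')]
    · rintro (i | i) (j | j)
      · exact iff_of_false (G.loopless.irrefl z) (by simp)
      · simpa using! (hW _ (e j).2).2
      · simpa using! (hW _ (e i).2).2.symm
      · simpa using! hW' _ (e i).2 _ (e j).2

theorem clawNumber_induce_le {X : Set V} {v : ℕ}
    (h : ∀ z ∈ X, ∀ W : Finset V, (∀ w ∈ W, w ∈ X ∧ G.Adj z w) →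
      (∀ w ∈ W, ∀ w' ∈ W, ¬ G.Adj w w') → W.card ≠ v + 1) : clawNumber (G.induce X) ≤ v := by
  refine csSup_le' ?_
  rintro k ⟨e⟩
  by_contra! hk
  let f : Fin (v + 1) ↪ V := ⟨fun i => (e (Sum.inr (Fin.castLE hk i))).1, fun i j hij => by
    have := e.injective (Subtype.ext hij)
    simpa using this⟩
  refine h (e (Sum.inl 0)).1 (e (Sum.inl 0)).2 (Finset.univ.map f) ?_ ?_ (by simp)
  · intro w hw
    obtain ⟨i, -, rfl⟩ := Finset.mem_map.1 hw
    refine ⟨(e (Sum.inr (Fin.castLE hk i))).2, ?_⟩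
    have := e.map_adj_iff (v := Sum.inl 0) (w := Sum.inr (Fin.castLE hk i))
    simpa using! this
  · intro w hw w' hw'
    obtain ⟨i, -, rfl⟩ := Finset.mem_map.1 hw
    obtain ⟨j, -, rfl⟩ := Finset.mem_map.1 hw'
    have := e.map_adj_iff (v := Sum.inr (Fin.castLE hk i)) (w := Sum.inr (Fin.castLE hk j))
    simpa using! this

/-- The lower bound on the optimum: the vertices dominated by a vertex of level `j` lie in at
least `j + 1` parts. Otherwise the `v + 1` packed vertices that raised the level see the same
parts below them; one of these is the part of `z`, which gives a claw with centre `z`. -/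
theorem level_lt_card {v : ℕ} {c : V → ℕ} (hc : IsClawPartition G v c) (hv : 1 ≤ v) (k : ℕ) :
    ∀ z, ∃ C : Finset ℕ, level G v k z < C.card ∧
      ∀ a ∈ C, ∃ u, Dominates G z u ∧ c u = a := by
  induction k with
  | zero => exact fun z => ⟨{c z}, by simp [level], by simpa using ⟨z, Dominates.refl z, rfl⟩⟩
  | succ k ih =>
    intro z
    rw [level]
    split_ifs with hz
    swap
    · exact ih z
    obtain ⟨hzk, W, hW, h1, h2⟩ := hz
    classical
    -- The parts that meet the set of vertices dominated by `z`.
    refine ⟨(Finset.univ.filter (Dominates G z)).image c, ?_, by simp⟩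
    by_contra! hlt
    set B := (Finset.univ.filter (Dominates G z)).image c
    have hzB : c z ∈ B :=
      Finset.mem_image.2 ⟨z, by simpa using Dominates.refl z, rfl⟩
    have hsub : ∀ w ∈ W, ∃ u, Dominates G w u ∧ c u = c z := by
      intro w hw
      obtain ⟨C, hC, hC'⟩ := ih w
      have hCB : C ⊆ B := by
        intro a ha
        obtain ⟨u, hu, rfl⟩ := hC' a ha
        exact Finset.mem_image.2 ⟨u, by simpa using (h1 w hw).2.trans hu, rfl⟩
      have := (h1 w hw).1
      have hEq : C = B := Finset.eq_of_subset_of_card_le hCB (by omega)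
      exact hC' _ (hEq ▸ hzB)
    choose! g hg hgc using hsub
    have hinj : Set.InjOn g W := by
      intro w hw w' hw' h
      by_contra hne
      exact (Dominates.not_adj hne (h2 w hw w' hw') (hg w hw) (hg w' hw')).1 h
    have hcard : (W.image g).card = v + 1 := by rw [Finset.card_image_of_injOn hinj, hW]
    have hle : (W.image g).card ≤ v := by
      refine card_le_of_clawNumber_le (hc (c z)) (z := z) rfl ?_ ?_
      · intro u hu
        obtain ⟨w, hw, rfl⟩ := Finset.mem_image.1 hu
        refine ⟨hgc w hw, ((h1 w hw).2.trans (hg w hw)).adj fun hgz => ?_⟩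
        -- A second packed vertex is dominated by `z`, hence by `w` if `g w = z`.
        obtain ⟨w', hw', hne⟩ := Finset.exists_mem_ne (show 1 < W.card by omega) w
        have hz := hg w hw
        rw [hgz] at hz
        exact (Dominates.not_adj hne.symm (h2 w hw w' hw') (hz.trans (h1 w' hw').2)
          (Dominates.refl w')).1 rfl
      · intro u hu u' hu'
        obtain ⟨w, hw, rfl⟩ := Finset.mem_image.1 hu
        obtain ⟨w', hw', rfl⟩ := Finset.mem_image.1 hu'
        rcases eq_or_ne w w' with rfl | hne
        · exact G.loopless.irrefl _
        · exact (Dominates.not_adj hne (h2 w hw w' hw') (hg w hw) (hg w' hw')).2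
    omega

theorem level_lt_numParts {v : ℕ} {c : V → ℕ} (hc : IsClawPartition G v c) (hv : 1 ≤ v) (k : ℕ)
    (z : V) : level G v k z < numParts c := by
  obtain ⟨C, hC, hC'⟩ := level_lt_card hc hv k z
  refine hC.trans_le (Finset.card_le_card fun a ha => ?_)
  obtain ⟨u, -, rfl⟩ := hC' a ha
  simp

theorem exists_isClawPartition_numParts_le (v : ℕ) :
    ∃ c : V → ℕ, IsClawPartition G v c ∧ numParts c ≤ Fintype.card V := by
  refine ⟨fun x => Fintype.equivFin V x, fun a => clawNumber_induce_le ?_, Finset.card_image_le⟩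
  intro z hz W hW _ hc
  obtain ⟨w, hw⟩ : W.Nonempty := Finset.card_pos.1 (by omega)
  have h : w = z := (Fintype.equivFin V).injective (Fin.ext ((hW w hw).1.trans hz.symm))
  exact (hW w hw).2.ne h.symm

theorem level_lt_minParts {v : ℕ} (hv : 1 ≤ v) (k : ℕ) (z : V) :
    level G v k z < minParts G v := by
  obtain ⟨c, hc, -⟩ := exists_isClawPartition_numParts_le (G := G) v
  obtain ⟨c', hc', h⟩ :=
    Nat.sInf_mem (s := {k : ℕ | ∃ c : V → ℕ, IsClawPartition G v c ∧ numParts c = k})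
      ⟨_, c, hc, rfl⟩
  exact (level_lt_numParts hc' hv k z).trans_eq h

theorem level_lt_card_vertices {v : ℕ} (hv : 1 ≤ v) (k : ℕ) (z : V) :
    level G v k z < Fintype.card V := by
  obtain ⟨c, hc, h⟩ := exists_isClawPartition_numParts_le (G := G) v
  exact (level_lt_numParts hc hv k z).trans_le h

/-- A labelling that refines the levels by `ρ` further labels has at most `ρ` times the optimal
number of parts. -/
theorem numParts_le_mul_minParts {v : ℕ} (hv : 1 ≤ v) {ρ k : ℕ} {b : V → ℕ}
    (hb : ∀ z, b z < ρ) :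
    numParts (fun z => ρ * level G v k z + b z) ≤ ρ * minParts G v := by
  have : Finset.univ.image (fun z => ρ * level G v k z + b z) ⊆
      Finset.range (ρ * minParts G v) := by
    intro a ha
    obtain ⟨z, -, rfl⟩ := Finset.mem_image.1 ha
    have h1 := Nat.mul_le_mul_left ρ (level_lt_minParts (G := G) hv k z)
    have h2 := hb z
    rw [Nat.mul_succ] at h1
    rw [Finset.mem_range]
    omega
  simpa [numParts] using Finset.card_le_card this

end Levels

/-! ### Interval representations -/

section Intervals

variable {V : Type*} {G : SimpleGraph V}

/-- The intervals `(l x, r x)` represent the graph `G`. -/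
structure IsRep (G : SimpleGraph V) (l r : V → ℝ) : Prop where
  lt : ∀ x, l x < r x
  adj : ∀ x y, G.Adj x y ↔ x ≠ y ∧ l x < r y ∧ l y < r x

theorem IsIntervalGraph.exists_isRep (h : IsIntervalGraph G) : ∃ l r, IsRep G l r := by
  obtain ⟨l, r, hlt, hadj⟩ := h
  refine ⟨l, r, hlt, fun x y => ?_⟩
  rw [hadj, Set.Ioo_inter_Ioo, Set.nonempty_Ioo, max_lt_iff, lt_min_iff, lt_min_iff]
  have := hlt x
  have := hlt y
  tauto

namespace IsRep

variable {l r : V → ℝ} (h : IsRep G l r)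
include h

/-- The reflection of a representation in the origin. -/
theorem neg : IsRep G (fun x => -r x) (fun x => -l x) where
  lt x := by simpa using h.lt x
  adj x y := by
    rw [h.adj, neg_lt_neg_iff, neg_lt_neg_iff]
    tauto

theorem dominates {z w : V} (hl : l z ≤ l w) (hr : r w ≤ r z) : Dominates G z w := by
  rintro u hu
  by_cases huz : u = z
  · exact Or.inl huz
  · refine Or.inr ((h.adj z u).2 ⟨Ne.symm huz, ?_⟩)
    rcases hu with rfl | hu
    · have := h.lt u
      exact ⟨by linarith, by linarith⟩
    · obtain ⟨-, h1, h2⟩ := (h.adj w u).1 hu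
      exact ⟨by linarith, by linarith⟩

theorem le_of_not_adj {x y : V} (hne : x ≠ y) (hxy : ¬ G.Adj x y) (hl : l x ≤ l y) :
    r x ≤ l y := by
  by_contra! hlt
  exact hxy ((h.adj x y).2 ⟨hne, by linarith [h.lt y], hlt⟩)

theorem separated {x y : V} (hne : x ≠ y) (hxy : ¬ G.Adj x y) : r x ≤ l y ∨ r y ≤ l x := by
  rcases le_total (l x) (l y) with hl | hl
  · exact Or.inl (h.le_of_not_adj hne hxy hl)
  · exact Or.inr (h.le_of_not_adj hne.symm (fun h' => hxy h'.symm) hl)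

/-- The centre of a claw dominates all leaves of the claw but the leftmost and the
rightmost one. -/
theorem exists_dominated_leaves {z : V} {W : Finset V} (hW : ∀ w ∈ W, G.Adj z w)
    (hW' : ∀ w ∈ W, ∀ w' ∈ W, ¬ G.Adj w w') :
    ∃ U ⊆ W, W.card ≤ U.card + 2 ∧ ∀ w ∈ U, Dominates G z w := by
  classical
  rcases W.eq_empty_or_nonempty with rfl | hne
  · exact ⟨∅, subset_rfl, by simp, by simp⟩
  obtain ⟨a, ha, hamin⟩ := W.exists_min_image l hne
  obtain ⟨b, hb, hbmax⟩ := W.exists_max_image l hne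
  refine ⟨(W.erase a).erase b, (Finset.erase_subset _ _).trans (Finset.erase_subset _ _), ?_, ?_⟩
  · have h1 := Finset.pred_card_le_card_erase (s := W) (a := a)
    have h2 := Finset.pred_card_le_card_erase (s := W.erase a) (a := b)
    omega
  · intro w hw
    obtain ⟨hwb, hwa, hw⟩ : w ≠ b ∧ w ≠ a ∧ w ∈ W := by simpa using hw
    have h1 := h.le_of_not_adj hwa.symm (hW' a ha w hw) (hamin w hw)
    have h2 := h.le_of_not_adj hwb (hW' w hw b hb) (hbmax w hw)
    have h3 := (h.adj z a).1 (hW a ha)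
    have h4 := (h.adj z b).1 (hW b hb)
    exact h.dominates (by linarith) (by linarith)

end IsRep

end Intervals

/-! ### Two parts for each level -/

section TwoParts

variable {V : Type*} [Fintype V] {G : SimpleGraph V}

/-- The vertices of one level are split according to whether they pack `v - 1` vertices. If such
a vertex is the centre of a claw with `v + 1` leaves of the same kind, then the at least
`v - 1 ≥ 2` dominated leaves pack `v - 1` vertices each, so that the centre packs
`2 * (v - 1) ≥ v + 1` vertices. -/
theorem isClawPartition_two {v : ℕ} (hv : 3 ≤ v) (hG : IsIntervalGraph G) {f : V → ℕ}
    (hf : ∀ z, ¬ Packs G f z (v + 1)) {b : V → ℕ}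
    (hb : ∀ z, b z = 0 ∧ ¬ Packs G f z (v - 1) ∨ b z = 1 ∧ Packs G f z (v - 1)) :
    IsClawPartition G v (fun z => 2 * f z + b z) := by
  classical
  obtain ⟨l, r, h⟩ := hG.exists_isRep
  refine fun a => clawNumber_induce_le fun z hz W hW hW' hcard => ?_
  have hsame : ∀ w ∈ W, f w = f z ∧ b w = b z := by
    intro w hw
    have h1 : 2 * f w + b w = a := (hW w hw).1
    have h2 : 2 * f z + b z = a := hz
    have h3 : b w ≤ 1 := by rcases hb w with h | h <;> omega
    have h4 : b z ≤ 1 := by rcases hb z with h | h <;> omega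
    omega
  obtain ⟨U, hUW, hU, hdom⟩ := h.exists_dominated_leaves (fun w hw => (hW w hw).2) hW'
  have hpack : Packs G f z (v - 1) :=
    Packs.mono (W := U) (by omega) (fun w hw => ⟨(hsame w (hUW hw)).1.ge, hdom w hw⟩)
      fun w hw w' hw' => hW' w (hUW hw) w' (hUW hw')
  have hbz : b z = 1 := by
    rcases hb z with h | h
    · exact absurd hpack h.2
    · exact h.1
  obtain ⟨x, hx, y, hy, hxy⟩ := Finset.one_lt_card.1 (show 1 < U.card by omega)
  have hpacks : ∀ w ∈ U, Packs G f w (v - 1) := by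
    intro w hw
    rcases hb w with h | h
    · have := (hsame w (hUW hw)).2
      omega
    · exact h.2
  obtain ⟨X, hXc, hX, hX'⟩ := hpacks x hx
  obtain ⟨Y, hYc, hY, hY'⟩ := hpacks y hy
  have hsep : ∀ u ∈ X, ∀ u' ∈ Y, u ≠ u' ∧ ¬ G.Adj u u' := fun u hu u' hu' =>
    Dominates.not_adj hxy (hW' x (hUW hx) y (hUW hy)) (hX u hu).2 (hY u' hu').2
  have hdisj : Disjoint X Y :=
    Finset.disjoint_left.2 fun u hu hu' => (hsep u hu u hu').1 rfl
  refine hf z (Packs.mono (W := X ∪ Y) ?_ ?_ ?_)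
  · rw [Finset.card_union_of_disjoint hdisj]
    omega
  · intro w hw
    rcases Finset.mem_union.1 hw with hw | hw
    · exact ⟨(hsame x (hUW hx)).1.ge.trans (hX w hw).1, (hdom x hx).trans (hX w hw).2⟩
    · exact ⟨(hsame y (hUW hy)).1.ge.trans (hY w hw).1, (hdom y hy).trans (hY w hw).2⟩
  · intro w hw w' hw'
    rcases Finset.mem_union.1 hw with hw | hw <;> rcases Finset.mem_union.1 hw' with hw' | hw'
    · exact hX' w hw w' hw'
    · exact (hsep w hw w' hw').2
    · exact fun h => (hsep w' hw' w hw).2 h.symm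
    · exact hY' w hw w' hw'

end TwoParts

/-! ### Three parts for each level -/

section ThreeParts

variable {V : Type*} {G : SimpleGraph V}

/-- Adjacency within the classes of equal labels `f`. -/
def SameAdj (G : SimpleGraph V) (f : V → ℕ) (x y : V) : Prop := G.Adj x y ∧ f x = f y

/-- The neighbours of `s` with the same label are pairwise adjacent. -/
def SameSimplicial (G : SimpleGraph V) (f : V → ℕ) (s : V) : Prop :=
  ∀ x y, SameAdj G f s x → SameAdj G f s y → x = y ∨ G.Adj x y

/-- `D` is the distance, increased by `1`, from the root `ρ x` of the component of `x`, for the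
components of the graph `SameAdj G f`. The roots are simplicial. -/
structure IsLayering (G : SimpleGraph V) (f : V → ℕ) (D : V → ℕ) (ρ : V → V) : Prop where
  pos : ∀ x, D x ≠ 0
  le_succ : ∀ x y, SameAdj G f x y → D y ≤ D x + 1
  root_eq : ∀ x y, SameAdj G f x y → ρ x = ρ y
  root : ∀ x, D x = 1 → x = ρ x
  root_layer : ∀ x, D (ρ x) = 1
  pred : ∀ x, 1 < D x → ∃ y, SameAdj G f x y ∧ D y + 1 = D x
  label_root : ∀ x, f (ρ x) = f x
  simplicial : ∀ x, SameSimplicial G f (ρ x)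

/-- `y` is dominated by a neighbour in the preceding layer. -/
def IsCovered (G : SimpleGraph V) (f D : V → ℕ) (y : V) : Prop :=
  ∃ x, SameAdj G f x y ∧ D x + 1 = D y ∧ Dominates G x y

theorem SameAdj.symm {f : V → ℕ} {x y : V} (h : SameAdj G f x y) : SameAdj G f y x :=
  ⟨h.1.symm, h.2.symm⟩

namespace IsLayering

variable {f D : V → ℕ} {ρ : V → V} (hD : IsLayering G f D ρ)
include hD

/-- Since the vertices on a path to the root meet every position between the root and `x`, a
vertex to the right of the root starts after all vertices of preceding layers. -/
theorem left_le {l r : V → ℝ} (h : IsRep G l r) {u : V} (hu : r (ρ u) ≤ l u) :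
    ∀ (k : ℕ) (x : V), ρ x = ρ u → D x = k → k < D u → l x ≤ l u := by
  intro k
  induction k with
  | zero => exact fun x _ hx => absurd hx (hD.pos x)
  | succ k ih =>
    intro x hx hk hlt
    rcases Nat.eq_zero_or_pos k with rfl | hpos
    · have := hD.root x (by omega)
      have := h.lt (ρ u)
      rw [hD.root x (by omega), hx]
      linarith
    · obtain ⟨y, hxy, hy⟩ := hD.pred x (by omega)
      have hy' := ih y ((hD.root_eq x y hxy).symm.trans hx) (by omega) (by omega)
      by_contra! hlt'
      obtain ⟨-, h1, h2⟩ := (h.adj x y).1 hxy.1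
      have hyu : SameAdj G f y u := by
        refine ⟨(h.adj y u).2 ⟨?_, by linarith [h.lt u], by linarith⟩, ?_⟩
        · rintro rfl
          omega
        · rw [← hxy.2, ← hD.label_root x, hx, hD.label_root u]
      have := hD.le_succ y u hyu
      omega

/-- Independent vertices of one layer to the right of the root: a neighbour in the preceding
layer of the rightmost one contains all others. -/
theorem exists_last_of_right {l r : V → ℝ} (h : IsRep G l r) {d : ℕ} {s : V} {W : Finset V}
    (hne : W.Nonempty) (hW : ∀ w ∈ W, D w = d ∧ ρ w = s ∧ r s ≤ l w)
    (hW' : ∀ w ∈ W, ∀ w' ∈ W, ¬ G.Adj w w') :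
    ∃ a ∈ W, ∀ x, SameAdj G f x a → D x + 1 = d → ∀ w ∈ W, w ≠ a → Dominates G x w := by
  obtain ⟨a, ha, hmax⟩ := W.exists_max_image l hne
  refine ⟨a, ha, fun x hx hxd w hw hwa => ?_⟩
  obtain ⟨hwd, hws, hsw⟩ := hW w hw
  have h1 := h.le_of_not_adj hwa (hW' w hw a ha) (hmax w hw)
  have h2 := (h.adj x a).1 hx.1
  have h3 := hD.left_le h (u := w) (by rwa [hws]) (D x) x
    (by rw [hD.root_eq x a hx, (hW a ha).2.1, hws]) rfl (by omega)
  exact h.dominates h3 (by linarith)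

/-- The leaves of a claw within one layer, from the third on, have a member `a` such that
every neighbour of `a` in the preceding layer dominates all other leaves. The leaves are on one
side of the root, because they are adjacent to the centre, which is not adjacent to the root. -/
theorem exists_last {l r : V → ℝ} (h : IsRep G l r) {z : V} {W : Finset V} (hz : 2 < D z)
    (hne : W.Nonempty) (hW : ∀ w ∈ W, D w = D z ∧ SameAdj G f z w)
    (hW' : ∀ w ∈ W, ∀ w' ∈ W, ¬ G.Adj w w') :
    ∃ a ∈ W, ∀ x, SameAdj G f x a → D x + 1 = D z → ∀ w ∈ W, w ≠ a → Dominates G x w := by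
  have hfar : ∀ u, D u = D z → ρ u = ρ z → r (ρ z) ≤ l u ∨ r u ≤ l (ρ z) := by
    intro u hu hρ
    -- Adjacent to the root, or equal to it, are only vertices with `D u ≤ 2`.
    have hD1 := hD.root_layer z
    have hne : ρ z ≠ u := by
      rintro rfl
      omega
    refine h.separated hne fun hadj => ?_
    have := hD.le_succ (ρ z) u ⟨hadj, by rw [hD.label_root, ← hD.label_root u, hρ, hD.label_root]⟩
    omega
  have hρ : ∀ w ∈ W, ρ w = ρ z := fun w hw => (hD.root_eq z w (hW w hw).2).symm
  rcases hfar z rfl rfl with hside | hside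
  · refine hD.exists_last_of_right h (s := ρ z) hne (fun w hw => ⟨(hW w hw).1, hρ w hw, ?_⟩) hW'
    have h1 := (h.adj z w).1 (hW w hw).2.1
    rcases hfar w (hW w hw).1 (hρ w hw) with h2 | h2
    · exact h2
    · linarith [h.lt (ρ z)]
  · refine hD.exists_last_of_right h.neg (s := ρ z) hne
      (fun w hw => ⟨(hW w hw).1, hρ w hw, ?_⟩) hW'
    have h1 := (h.adj z w).1 (hW w hw).2.1
    rcases hfar w (hW w hw).1 (hρ w hw) with h2 | h2
    · linarith [h.lt (ρ z)]
    · simpa using h2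

/-- The first two layers of a component form a clique. -/
theorem adj_of_le_two {z x y : V} (hx : SameAdj G f z x) (hy : SameAdj G f z y)
    (hzx : D x = D z) (hzy : D y = D z) (hz : D z ≤ 2) : x = y ∨ G.Adj x y := by
  have hpos := hD.pos z
  have hroot : ∀ u, ρ u = ρ z → D u = D z → D z = 2 → SameAdj G f (ρ z) u := by
    intro u hu hu2 h2
    obtain ⟨u', huu', hu'⟩ := hD.pred u (by omega)
    have := hD.root u' (by omega)
    rw [← hD.root_eq u u' huu', hu] at this
    exact this ▸ huu'.symm
  rcases (by omega : D z = 1 ∨ D z = 2) with h1 | h1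
  · have h2 := hD.root x (by omega)
    have h3 := hD.root y (by omega)
    left
    rw [h2, h3, ← hD.root_eq z x hx, hD.root_eq z y hy]
  · exact hD.simplicial z x y (hroot x (hD.root_eq z x hx).symm hzx h1)
      (hroot y (hD.root_eq z y hy).symm hzy h1)

end IsLayering

/-- Covered vertices form one part, and the other vertices are split according to the parity
of their layer. Adjacent vertices of one part are then in the same layer, since a vertex covered
from layer `d - 1` has no neighbour in layer `d + 1`. Let `W` be the leaves of a claw within a
part, and `a ∈ W` as in `IsLayering.exists_last`. If `a` is not covered, then a neighbour of `a`
in the preceding layer still covers all other leaves; if `a` is covered by `x`, then `x` packs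
all leaves. -/
theorem isClawPartition_three [Fintype V] {v : ℕ} (hv : 1 ≤ v) (hG : IsIntervalGraph G)
    {f : V → ℕ} (hf : ∀ z, ¬ Packs G f z (v + 1)) {D : V → ℕ} {ρ : V → V}
    (hD : IsLayering G f D ρ) {b : V → ℕ}
    (hb : ∀ z, IsCovered G f D z ∧ b z = 2 ∨ ¬ IsCovered G f D z ∧ b z = D z % 2) :
    IsClawPartition G v (fun z => 3 * f z + b z) := by
  obtain ⟨l, r, h⟩ := hG.exists_isRep
  have hb3 : ∀ z, b z < 3 := by
    intro z
    rcases hb z with h | h <;> omega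
  have hbc : ∀ z, b z = 2 ↔ IsCovered G f D z := by
    intro z
    rcases hb z with h | h
    · simp [h]
    · simp only [h.1, iff_false]
      omega
  -- A covered vertex has no covered neighbour in the next layer.
  have hcov : ∀ y y', SameAdj G f y y' → IsCovered G f D y → D y' ≤ D y := by
    rintro y y' hyy' ⟨x, hxy, hx, hdom⟩
    rcases hdom y' (Or.inr hyy'.1) with rfl | h'
    · omega
    · have := hD.le_succ x y' ⟨h', hxy.2.trans hyy'.2⟩
      omega
  refine fun a => clawNumber_induce_le fun z hz W hW hW' hcard => ?_
  have hsame : ∀ w ∈ W, SameAdj G f z w ∧ b w = b z := by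
    intro w hw
    have h1 : 3 * f w + b w = a := (hW w hw).1
    have h2 : 3 * f z + b z = a := hz
    have h3 := hb3 w
    have h4 := hb3 z
    exact ⟨⟨(hW w hw).2, by omega⟩, by omega⟩
  have hlayer : ∀ w ∈ W, D w = D z := by
    intro w hw
    obtain ⟨h1, h2⟩ := hsame w hw
    rcases hb z with hbz | hbz
    · have h3 := hcov z w h1 hbz.1
      have h4 := hcov w z h1.symm ((hbc w).1 (by omega))
      omega
    · have h3 := hD.le_succ z w h1
      have h4 := hD.le_succ w z h1.symm
      rcases hb w with hbw | hbw <;> omega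
  obtain ⟨x, hx, y, hy, hxy⟩ := Finset.one_lt_card.1 (show 1 < W.card by omega)
  have hz2 : 2 < D z := by
    by_contra! hle
    rcases hD.adj_of_le_two (hsame x hx).1 (hsame y hy).1 (hlayer x hx) (hlayer y hy) hle
      with h' | h'
    · exact hxy h'
    · exact hW' x hx y hy h'
  obtain ⟨c, hc, hlast⟩ := hD.exists_last h hz2 ⟨x, hx⟩
    (fun w hw => ⟨hlayer w hw, (hsame w hw).1⟩) hW'
  by_cases hcc : IsCovered G f D c
  · obtain ⟨p, hpc, hp, hdom⟩ := hcc
    refine hf p ⟨W, hcard, fun w hw => ⟨?_, ?_⟩, hW'⟩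
    · have := hpc.2
      have := (hsame c hc).1.2
      have := (hsame w hw).1.2
      omega
    · rcases eq_or_ne w c with rfl | hwc
      · exact hdom
      · exact hlast p hpc (hp.trans (hlayer c hc)) w hw hwc
  · obtain ⟨p, hpc, hp⟩ := hD.pred c (by rw [hlayer c hc]; omega)
    obtain ⟨w, hw, hwc⟩ := Finset.exists_mem_ne (show 1 < W.card by omega) c
    have hdom := hlast p hpc.symm (hp.trans (hlayer c hc)) w hw hwc
    have hDw := hlayer w hw
    have hDc := hlayer c hc
    have hwcov : IsCovered G f D w := by
      refine ⟨p, ⟨hdom.adj ?_, ?_⟩, by omega, hdom⟩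
      · rintro rfl
        omega
      · have := hpc.2
        have := (hsame c hc).1.2
        have := (hsame w hw).1.2
        omega
    have h1 := (hsame w hw).2
    have h2 := (hsame c hc).2
    exact hcc ((hbc c).1 (by rw [h2, ← h1]; exact (hbc w).2 hwcov))

end ThreeParts

/-! ### Computation of a layering -/

section Layers

variable {n : ℕ} (G : SimpleGraph (Fin n)) (f : Fin n → ℕ)

open Classical in
/-- One round of breadth-first search: the unlabelled neighbours of the vertices with label
`r + 1` receive the label `r + 2`. -/
noncomputable def layerStep (r : ℕ) (D : Fin n → ℕ) (y : Fin n) : ℕ :=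
  if D y = 0 ∧ ∃ x, SameAdj G f x y ∧ D x = r + 1 then r + 2 else D y

/-- The labels after `k` rounds of breadth-first search. -/
noncomputable def search (D : Fin n → ℕ) : ℕ → Fin n → ℕ
  | 0 => D
  | r + 1 => layerStep G f r (search D r)

open Classical in
/-- An unlabelled simplicial vertex `s` becomes a root. -/
noncomputable def addRoot (s : ℕ) (D : Fin n → ℕ) (y : Fin n) : ℕ :=
  if (y : ℕ) = s ∧ D y = 0 ∧ SameSimplicial G f y then 1 else D y

/-- The labels after the vertices below `k` have been tried as roots. -/
noncomputable def layers : ℕ → Fin n → ℕ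
  | 0 => fun _ => 0
  | k + 1 => search G f (addRoot G f k (layers k)) n

/-- The labels `D` form a layering of some of the components, and are `0` on the others. -/
structure IsPartialLayering (D : Fin n → ℕ) (ρ : Fin n → Fin n) : Prop where
  closed : ∀ x y, SameAdj G f x y → D x ≠ 0 → D y ≠ 0 ∧ D y ≤ D x + 1 ∧ ρ x = ρ y
  root : ∀ x, D x = 1 → x = ρ x
  root_layer : ∀ x, D x ≠ 0 → D (ρ x) = 1
  pred : ∀ x, 1 < D x → ∃ y, SameAdj G f x y ∧ D y + 1 = D x
  label_root : ∀ x, D x ≠ 0 → f (ρ x) = f x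
  simplicial : ∀ x, D x ≠ 0 → SameSimplicial G f (ρ x)
  le : ∀ x, D x ≤ n

/-- The invariant of the breadth-first search from `s`, where `D` are the labels before the
search: `E` coincides with `D` on the old components and labels the vertices at distance at most
`r` from `s`. -/
structure IsSearch (D : Fin n → ℕ) (s : Fin n) (r : ℕ) (E : Fin n → ℕ) : Prop where
  old : ∀ x, D x ≠ 0 → E x = D x
  le : ∀ x, D x = 0 → E x ≤ r + 1
  root : ∀ x, D x = 0 → E x = 1 → x = s
  start : E s = 1
  pred : ∀ x, D x = 0 → 1 < E x → ∃ y, D y = 0 ∧ SameAdj G f x y ∧ E y + 1 = E x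
  next : ∀ x y, D x = 0 → E x ≠ 0 → E x ≤ r → SameAdj G f x y → E y ≠ 0 ∧ E y ≤ E x + 1
  label : ∀ x, D x = 0 → E x ≠ 0 → f x = f s

variable {G f} {D : Fin n → ℕ} {ρ : Fin n → Fin n}

theorem IsSearch.step (hD : IsPartialLayering G f D ρ) {s : Fin n} {r : ℕ} {E : Fin n → ℕ}
    (hE : IsSearch G f D s r E) : IsSearch G f D s (r + 1) (layerStep G f r E) := by
  have hkeep : ∀ x, E x ≠ 0 → layerStep G f r E x = E x := fun x hx =>
    if_neg fun h => hx h.1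
  have hnew : ∀ x, D x = 0 → E x = 0 → layerStep G f r E x ≠ 0 →
      layerStep G f r E x = r + 2 ∧ ∃ y, D y = 0 ∧ SameAdj G f x y ∧ E y = r + 1 := by
    intro x hx hEx hne
    rw [layerStep] at hne ⊢
    split_ifs at hne ⊢ with h
    · obtain ⟨-, y, hyx, hy⟩ := h
      refine ⟨rfl, y, ?_, hyx.symm, hy⟩
      by_contra hDy
      exact (hD.closed y x hyx hDy).1 hx
    · exact absurd hEx hne
  refine ⟨?_, ?_, ?_, ?_, ?_, ?_, ?_⟩
  · intro x hx
    rw [hkeep x (by rwa [hE.old x hx]), hE.old x hx]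
  · intro x hx
    have := hE.le x hx
    rw [layerStep]
    split_ifs <;> omega
  · intro x hx h1
    by_cases hEx : E x = 0
    · have := (hnew x hx hEx (by omega)).1
      omega
    · exact hE.root x hx (by rwa [hkeep x hEx] at h1)
  · rw [hkeep s (by rw [hE.start]; omega), hE.start]
  · intro x hx h1
    by_cases hEx : E x = 0
    · obtain ⟨h2, y, hy, hxy, hEy⟩ := hnew x hx hEx (by omega)
      exact ⟨y, hy, hxy, by rw [hkeep y (by omega), h2, hEy]⟩
    · rw [hkeep x hEx] at h1 ⊢
      obtain ⟨y, hy, hxy, hEy⟩ := hE.pred x hx h1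
      exact ⟨y, hy, hxy, by rw [hkeep y (by omega), hEy]⟩
  · intro x y hx hne hle hxy
    by_cases hEx : E x = 0
    · have := (hnew x hx hEx hne).1
      omega
    · rw [hkeep x hEx] at hle ⊢
      have hDy : D y = 0 := by
        by_contra hDy
        exact (hD.closed y x hxy.symm hDy).1 hx
      have hley := hE.le y hDy
      by_cases hEy : E y = 0
      · have hxr : E x = r + 1 := by
          by_contra hne'
          exact (hE.next x y hx hEx (by omega) hxy).1 hEy
        rw [layerStep, if_pos ⟨hEy, x, hxy, hxr⟩]
        omega
      · rw [hkeep y hEy]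
        refine ⟨hEy, ?_⟩
        rcases (by omega : E x ≤ r ∨ E x = r + 1) with h | h
        · exact (hE.next x y hx hEx h hxy).2
        · omega
  · intro x hx hne
    by_cases hEx : E x = 0
    · obtain ⟨-, y, hy, hxy, hEy⟩ := hnew x hx hEx hne
      exact hxy.2.trans (hE.label y hy (by omega))
    · exact hE.label x hx hEx

/-- All values from `1` to a label occur as labels, so that the labels are at most `n`. -/
theorem IsSearch.le_card {s : Fin n} {r : ℕ} {E : Fin n → ℕ} (hE : IsSearch G f D s r E)
    {x : Fin n} (hx : D x = 0) : E x ≤ n := by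
  have key : ∀ k, ∀ x, D x = 0 → E x = k → Finset.Icc 1 k ⊆ Finset.univ.image E := by
    intro k
    induction k with
    | zero => simp
    | succ k ih =>
      intro x hx hk j hj
      rw [Finset.mem_Icc] at hj
      rcases eq_or_ne j (k + 1) with rfl | hjk
      · exact Finset.mem_image.2 ⟨x, Finset.mem_univ x, hk⟩
      · obtain ⟨y, hy, -, hyx⟩ := hE.pred x hx (by omega)
        exact ih y hy (by omega) (Finset.mem_Icc.2 (by omega))
  have h1 := Finset.card_le_card (key _ x hx rfl)
  have h2 := Finset.card_image_le (s := (Finset.univ : Finset (Fin n))) (f := E)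
  simp only [Nat.card_Icc, Finset.card_univ, Fintype.card_fin] at h1 h2
  omega

theorem IsSearch.isPartialLayering (hD : IsPartialLayering G f D ρ) {s : Fin n}
    (hs : SameSimplicial G f s) {E : Fin n → ℕ} (hE : IsSearch G f D s n E) :
    IsPartialLayering G f E (fun x => if D x = 0 then s else ρ x) := by
  have hroot : ∀ x, D x ≠ 0 → D (ρ x) ≠ 0 := fun x hx => by rw [hD.root_layer x hx]; omega
  have hold : ∀ x y, SameAdj G f x y → (D x = 0 ↔ D y = 0) := fun x y hxy =>
    not_iff_not.1 ⟨fun h => (hD.closed x y hxy h).1, fun h => (hD.closed y x hxy.symm h).1⟩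
  refine ⟨?_, ?_, ?_, ?_, ?_, ?_, ?_⟩
  · intro x y hxy hne
    by_cases hx : D x = 0
    · have hy := (hold x y hxy).1 hx
      have := hE.next x y hx hne (hE.le_card hx) hxy
      simpa [hx, hy] using this
    · have hy := mt (hold x y hxy).2 hx
      have := hD.closed x y hxy hx
      rw [hE.old x hx, hE.old y hy]
      simpa [hx, hy] using this
  · intro x h1
    split_ifs with hx
    · exact hE.root x hx h1
    · exact hD.root x (by rwa [hE.old x hx] at h1)
  · intro x hne
    split_ifs with hx
    · exact hE.start
    · rw [hE.old _ (hroot x hx), hD.root_layer x hx]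
  · intro x h1
    by_cases hx : D x = 0
    · obtain ⟨y, -, hy⟩ := hE.pred x hx h1
      exact ⟨y, hy⟩
    · rw [hE.old x hx] at h1 ⊢
      obtain ⟨y, hxy, hy⟩ := hD.pred x h1
      exact ⟨y, hxy, by rw [hE.old y (mt (hold x y hxy).2 hx), hy]⟩
  · intro x hne
    split_ifs with hx
    · exact (hE.label x hx hne).symm
    · exact hD.label_root x hx
  · intro x hne
    split_ifs with hx
    · exact hs
    · exact hD.simplicial x hx
  · intro x
    by_cases hx : D x = 0
    · exact hE.le_card hx
    · exact (hE.old x hx).trans_le (hD.le x)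

theorem search_eq_self (hD : IsPartialLayering G f D ρ) (r : ℕ) : search G f D r = D := by
  induction r with
  | zero => rfl
  | succ r ih =>
    rw [search, ih]
    funext y
    refine if_neg ?_
    rintro ⟨hy, x, hxy, hx⟩
    exact (hD.closed x y hxy (by omega)).1 hy

theorem isSearch_search (hD : IsPartialLayering G f D ρ) {s : Fin n} (hDs : D s = 0)
    {D₀ : Fin n → ℕ} (hD₀ : ∀ x, D₀ x = if x = s then 1 else D x) (r : ℕ) :
    IsSearch G f D s r (search G f D₀ r) := by
  induction r with
  | zero =>
    have h : ∀ x, x ≠ s → D₀ x = D x := fun x hx => by rw [hD₀, if_neg hx]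
    have hs : D₀ s = 1 := by rw [hD₀, if_pos rfl]
    have key : ∀ x, D x = 0 → D₀ x ≠ 0 → x = s := by
      intro x hx hne
      by_contra hxs
      exact hne ((h x hxs).trans hx)
    rw [search]
    refine ⟨?_, ?_, ?_, hs, ?_, ?_, ?_⟩
    · intro x hx
      exact h x fun hxs => hx (hxs ▸ hDs)
    · intro x hx
      rw [hD₀]
      split_ifs <;> omega
    · exact fun x hx h1 => key x hx (by omega)
    · intro x hx h1
      rw [key x hx (by omega), hs] at h1
      omega
    · intro x y hx hne hle
      omega
    · intro x hx hne
      rw [key x hx hne]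
  | succ r ih => exact ih.step hD

theorem exists_isPartialLayering_layers (k : ℕ) :
    ∃ ρ, IsPartialLayering G f (layers G f k) ρ ∧
      ∀ s : Fin n, (s : ℕ) < k → SameSimplicial G f s → layers G f k s ≠ 0 := by
  induction k with
  | zero =>
    refine ⟨id, ⟨?_, ?_, ?_, ?_, ?_, ?_, ?_⟩, ?_⟩ <;> simp [layers]
  | succ k ih =>
    obtain ⟨ρ, hρ, hs⟩ := ih
    rw [layers]
    by_cases hk : ∃ s : Fin n, (s : ℕ) = k ∧ layers G f k s = 0 ∧ SameSimplicial G f s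
    · obtain ⟨s, rfl, h0, hsimp⟩ := hk
      have hE := isSearch_search hρ h0 (D₀ := addRoot G f s (layers G f s)) (fun x => by
        rw [addRoot]
        by_cases hx : x = s
        · subst hx
          rw [if_pos ⟨rfl, h0, hsimp⟩, if_pos rfl]
        · rw [if_neg (fun h => hx (Fin.ext h.1)), if_neg hx]) n
      refine ⟨_, hE.isPartialLayering hρ hsimp, fun x hx hxs => ?_⟩
      rcases (by omega : (x : ℕ) < s ∨ (x : ℕ) = s) with h | h
      · have := hs x h hxs
        rwa [hE.old x this]
      · rw [Fin.ext h, hE.start]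
        exact one_ne_zero
    · have : addRoot G f k (layers G f k) = layers G f k := by
        funext y
        exact if_neg fun h => hk ⟨y, h⟩
      rw [this, search_eq_self hρ]
      refine ⟨ρ, hρ, fun x hx hxs => ?_⟩
      rcases (by omega : (x : ℕ) < k ∨ (x : ℕ) = k) with h | h
      · exact hs x h hxs
      · exact fun h0 => hk ⟨x, h, h0, hxs⟩

/-- In an interval graph every component has a simplicial vertex, the one with the leftmost
right end. Hence all components have been searched in the end. -/
theorem exists_isLayering_layers (hG : IsIntervalGraph G) :
    (∃ ρ, IsLayering G f (layers G f n) ρ) ∧ ∀ x, layers G f n x ≤ n := by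
  obtain ⟨ρ, hρ, hs⟩ := exists_isPartialLayering_layers (G := G) (f := f) n
  have hpos : ∀ x, layers G f n x ≠ 0 := by
    by_contra! hne
    obtain ⟨l, r, h⟩ := hG.exists_isRep
    obtain ⟨u, hu, hmin⟩ := (Finset.univ.filter fun x => layers G f n x = 0).exists_min_image r
      (by obtain ⟨x, hx⟩ := hne; exact ⟨x, by simpa using hx⟩)
    have hu0 : layers G f n u = 0 := by simpa using hu
    have hnbr : ∀ x, SameAdj G f u x → l x < r u ∧ r u ≤ r x := by
      intro x hx
      refine ⟨((h.adj u x).1 hx.1).2.2, hmin x ?_⟩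
      by_contra hx0
      exact (hρ.closed x u hx.symm (by simpa using hx0)).1 hu0
    refine hs u u.2 (fun x y hx hy => ?_) hu0
    have h1 := hnbr x hx
    have h2 := hnbr y hy
    refine or_iff_not_imp_left.2 fun hxy => (h.adj x y).2 ⟨hxy, by linarith, by linarith⟩
  refine ⟨⟨ρ, ?_⟩, hρ.le⟩
  exact ⟨hpos, fun x y hxy => (hρ.closed x y hxy (hpos x)).2.1,
    fun x y hxy => (hρ.closed x y hxy (hpos x)).2.2, hρ.root,
    fun x => hρ.root_layer x (hpos x), hρ.pred, fun x => hρ.label_root x (hpos x),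
    fun x => hρ.simplicial x (hpos x)⟩

end Layers

/-! ### Formulas and arrays -/

namespace RAM

/-- An expression is true if its value is not zero. -/
def Term.Holds (n : ℕ) (m ρ : ℕ → ℕ) (a : Term) : Prop := a.eval n m ρ ≠ 0

/-- Negation. -/
def Term.not (a : Term) : Term := .sub (.lit 1) a

/-- Conjunction. -/
def Term.and (a b : Term) : Term := .ite a b (.lit 0)

/-- Disjunction. -/
def Term.or (a b : Term) : Term := .ite a (.lit 1) b

/-- The comparison `a ≤ b`. -/
def Term.le (a b : Term) : Term := .not (.sub a b)

/-- Equality. -/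
def Term.eq (a b : Term) : Term := .and (.le a b) (.le b a)

/-- Adjacency of the vertices `i` and `j` (variables). The row offset in the adjacency matrix is
a product, and hence computed as a sum. -/
def Term.adj (i j : ℕ) : Term := .load (.add (.sum (i + 1) (.var i)) (.var j))

/-- The entry of the array `j` at the vertex `i` (a variable). The arrays are stored row by row
after the adjacency matrix and the output array. -/
def Term.arr (j i : ℕ) : Term := .load (.add (.sum 0 (.add .size (.lit (1 + j)))) (.var i))

/-- Assign the values of `e`, as a function of variable `0`, to the row `n + j` of the memory. -/
def Cmd.fill (j : ℕ) (e : Term) : Cmd :=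
  .each 0 (.store (.add (.sum 1 (.add .size (.lit j))) (.var 0)) e)

/-- Assign the values of `e`, as a function of variable `0`, simultaneously to the array `j`.
The output array serves as a buffer. -/
def Cmd.assign (j : ℕ) (e : Term) : Cmd :=
  .seq (.fill 0 e) (.fill (j + 1) (.load (.add (.sum 1 .size) (.var 0))))

section

variable {n : ℕ} {m ρ : ℕ → ℕ} {a b : Term}

open Term

@[simp]
theorem holds_not : (Term.not a).Holds n m ρ ↔ ¬ a.Holds n m ρ := by
  simp only [Holds, Term.not, eval]
  omega

@[simp]
theorem holds_and : (Term.and a b).Holds n m ρ ↔ a.Holds n m ρ ∧ b.Holds n m ρ := by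
  simp only [Holds, Term.and, eval]
  split_ifs <;> simp_all

@[simp]
theorem holds_or : (Term.or a b).Holds n m ρ ↔ a.Holds n m ρ ∨ b.Holds n m ρ := by
  simp only [Holds, Term.or, eval]
  split_ifs <;> simp_all

@[simp]
theorem holds_le : (Term.le a b).Holds n m ρ ↔ a.eval n m ρ ≤ b.eval n m ρ := by
  rw [Term.le, holds_not]
  simp only [Holds, eval]
  omega

@[simp]
theorem holds_eq : (Term.eq a b).Holds n m ρ ↔ a.eval n m ρ = b.eval n m ρ := by
  simp only [Term.eq, holds_and, holds_le]
  omega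

/-- A sum is a bounded existential quantifier. -/
@[simp]
theorem holds_sum {i : ℕ} :
    (Term.sum i a).Holds n m ρ ↔ ∃ x : Fin n, a.Holds n m (Function.update ρ i x) := by
  simp only [Holds, eval, ne_eq, Finset.sum_eq_zero_iff, Finset.mem_range]
  push Not
  exact ⟨fun ⟨x, hx, h⟩ => ⟨⟨x, hx⟩, h⟩, fun ⟨x, h⟩ => ⟨x, x.2, h⟩⟩

theorem eval_ite_holds {c : Term} [Decidable (c.Holds n m ρ)] :
    (Term.ite c a b).eval n m ρ = if c.Holds n m ρ then a.eval n m ρ else b.eval n m ρ := by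
  simp only [eval, Holds]
  congr

/-- The memory `m` holds the adjacency matrix of `G` and the arrays `A j`. -/
structure Rep (n : ℕ) (m : ℕ → ℕ) (G : SimpleGraph (Fin n)) (A : ℕ → Fin n → ℕ) : Prop where
  adj : ∀ x y : Fin n, m (n * x + y) ≠ 0 ↔ G.Adj x y
  arr : ∀ j (x : Fin n), m (n * (n + (1 + j)) + x) = A j x

variable {G : SimpleGraph (Fin n)} {A : ℕ → Fin n → ℕ}

theorem Rep.holds_adj (h : Rep n m G A) {i j : ℕ} {x y : Fin n} (hi : ρ i = x) (hj : ρ j = y) :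
    (Term.adj i j).Holds n m ρ ↔ G.Adj x y := by
  rw [← h.adj, Holds, Term.adj]
  simp [eval, hi, hj]

theorem Rep.eval_arr (h : Rep n m G A) {i j : ℕ} {x : Fin n} (hi : ρ i = x) :
    (Term.arr j i).eval n m ρ = A j x := by
  rw [← h.arr, Term.arr]
  simp [eval, hi]

theorem run_fill {j : ℕ} {e : Term} {f : Fin n → ℕ}
    (he : ∀ m' : ℕ → ℕ, (∀ a, (a < n * (n + j) ∨ n * (n + j) + n ≤ a) → m' a = m a) →
      ∀ x : Fin n, e.eval n m' (Function.update ρ 0 x) = f x) :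
    (∀ x : Fin n, (Cmd.fill j e).run n ρ m (n * (n + j) + x) = f x) ∧
      ∀ a, (a < n * (n + j) ∨ n * (n + j) + n ≤ a) → (Cmd.fill j e).run n ρ m a = m a := by
  set B := n * (n + j) with hB
  rw [Cmd.fill, Cmd.run]
  set g : ℕ → ℕ → ℕ := fun k => Nat.rec m (fun k m' => Cmd.run n (.store
    (.add (.sum 1 (.add .size (.lit j))) (.var 0)) e) (Function.update ρ 0 k) m') k with hg
  have key : ∀ k ≤ n, (∀ x : Fin n, (x : ℕ) < k → g k (B + x) = f x) ∧
      ∀ a, (a < B ∨ B + n ≤ a) → g k a = m a := by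
    intro k
    induction k with
    | zero => exact fun _ => ⟨fun x hx => absurd hx (by omega), fun a _ => rfl⟩
    | succ k ih =>
      intro hk
      obtain ⟨h1, h2⟩ := ih (by omega)
      have hstep : g (k + 1) = Function.update (g k) (B + k) (f ⟨k, hk⟩) := by
        rw [← he (g k) h2 ⟨k, hk⟩]
        simp [hg, Cmd.run, eval, hB]
      rw [hstep]
      refine ⟨fun x hx => ?_, fun a ha => ?_⟩
      · rcases (by omega : (x : ℕ) < k ∨ (x : ℕ) = k) with h | h
        · rw [Function.update_of_ne (by omega), h1 x h]
        · subst h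
          simp
      · rw [Function.update_of_ne (by omega), h2 a ha]
  exact ⟨fun x => (key n le_rfl).1 x x.2, (key n le_rfl).2⟩

/-- The row `n` of the memory does not meet the adjacency matrix and the arrays. -/
theorem Rep.congr (h : Rep n m G A) {m' : ℕ → ℕ}
    (hm : ∀ a, (a < n * n ∨ n * n + n ≤ a) → m' a = m a) : Rep n m' G A where
  adj x y := by
    rw [hm, h.adj]
    left
    have := Nat.mul_le_mul_left n (Nat.succ_le_of_lt x.2)
    rw [Nat.mul_succ] at this
    omega
  arr j x := by
    rw [hm, h.arr]
    right
    rw [mul_add, mul_add, mul_one]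
    omega

/-- Filling the output array. The expression must depend on the represented data only. -/
theorem Rep.fill (h : Rep n m G A) {e : Term} {f : Fin n → ℕ}
    (he : ∀ m', Rep n m' G A → ∀ x : Fin n, e.eval n m' (Function.update ρ 0 x) = f x) :
    Rep n ((Cmd.fill 0 e).run n ρ m) G A ∧
      ∀ x : Fin n, (Cmd.fill 0 e).run n ρ m (n * n + x) = f x := by
  have := run_fill (j := 0) (e := e) (f := f) fun m' hm' => he m' (h.congr hm')
  exact ⟨h.congr this.2, this.1⟩

theorem Rep.assign (h : Rep n m G A) {j : ℕ} {e : Term} {f : Fin n → ℕ}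
    (he : ∀ m', Rep n m' G A → ∀ x : Fin n, e.eval n m' (Function.update ρ 0 x) = f x) :
    Rep n ((Cmd.assign j e).run n ρ m) G (Function.update A j f) := by
  obtain ⟨h1, h2⟩ := h.fill (ρ := ρ) he
  rw [Cmd.assign, Cmd.run]
  set m₁ := (Cmd.fill 0 e).run n ρ m
  have hB : n * (n + (j + 1)) = n * n + n + n * j := by ring
  obtain ⟨h3, h4⟩ := run_fill (n := n) (m := m₁) (ρ := ρ) (j := j + 1)
    (e := .load (.add (.sum 1 .size) (.var 0))) (f := f) (by
      intro m' hm' x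
      rw [← h2 x, ← hm' (n * n + x) (by left; omega)]
      simp [eval])
  refine ⟨fun x y => ?_, fun k x => ?_⟩
  · rw [h4, h1.adj]
    left
    have := Nat.mul_le_mul_left n (Nat.succ_le_of_lt x.2)
    rw [Nat.mul_succ] at this
    omega
  · rcases eq_or_ne k j with rfl | hk
    · rw [Function.update_self, ← h3, add_comm 1 k]
    · rw [Function.update_of_ne hk, ← h1.arr, h4]
      have hC : n * (n + (1 + k)) = n * n + n + n * k := by ring
      rw [hC, hB]
      rcases Nat.lt_or_gt_of_ne hk with h | h
      · have := Nat.mul_le_mul_left n (Nat.succ_le_of_lt h)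
        rw [Nat.mul_succ] at this
        omega
      · have := Nat.mul_le_mul_left n (Nat.succ_le_of_lt h)
        rw [Nat.mul_succ] at this
        omega

theorem run_each_induction {i : ℕ} {c : Cmd} {P : ℕ → (ℕ → ℕ) → Prop} (h0 : P 0 m)
    (hP : ∀ k < n, ∀ m', P k m' → P (k + 1) (c.run n (Function.update ρ i k) m')) :
    P n ((Cmd.each i c).run n ρ m) := by
  rw [Cmd.run]
  have key : ∀ k ≤ n,
      P k (Nat.rec m (fun k m' => c.run n (Function.update ρ i k) m') k) := by
    intro k
    induction k with
    | zero => exact fun _ => h0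
    | succ k ih => exact fun hk => hP k (by omega) _ (ih (by omega))
  exact key n le_rfl

theorem rep_input (G : SimpleGraph (Fin n)) : Rep n (input G).mem G (fun _ _ => 0) where
  adj x y := by
    simp only [input, ne_eq, ite_eq_right_iff, one_ne_zero, imp_false, not_not]
    constructor
    · rintro ⟨i, j, h, hadj⟩
      have hn : 0 < n := x.pos
      have h1 : (x : ℕ) = i := by
        have := congrArg (· / n) h
        simpa [Nat.mul_add_div hn, Nat.div_eq_of_lt] using this
      have h2 : (y : ℕ) = j := by
        rw [h1] at h
        omega
      rwa [Fin.ext h1, Fin.ext h2]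
    · exact fun h => ⟨x, y, rfl, h⟩
  arr j x := by
    simp only [input]
    rw [if_neg]
    rintro ⟨i, i', h, -⟩
    have := Nat.mul_le_mul_left n (Nat.succ_le_of_lt i.2)
    rw [Nat.mul_succ] at this
    have : n * (n + (1 + j)) = n * n + n + n * j := by ring
    omega

/-! ### The algorithm -/

/-- The vertex `j` dominates the vertex `i` (variables). -/
def Term.dominates (j i : ℕ) : Term :=
  .not <| .sum (i + j + 1) <|
    .and (.or (.eq (.var (i + j + 1)) (.var i)) (.adj i (i + j + 1)))
      (.not (.or (.eq (.var (i + j + 1)) (.var j)) (.adj j (i + j + 1))))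

/-- The variable `3 + i` is different from and not adjacent to the variables `3 + j`,
`j < k`. -/
def Term.separate (i : ℕ) : ℕ → Term
  | 0 => .lit 1
  | k + 1 => .and (.not (.or (.eq (.var (3 + k)) (.var (3 + i))) (.adj (3 + k) (3 + i))))
      (separate i k)

/-- The vertices that are the values of the variables `3 + j`, `j < i`, can be extended by `k`
vertices as in `Packs`, for the labels in array `0` and the vertex in variable `0`. -/
def Term.extend : ℕ → ℕ → Term
  | 0, _ => .lit 1
  | k + 1, i => .sum (3 + i) <| .and (.le (.arr 0 0) (.arr 0 (3 + i))) <|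
      .and (.dominates 0 (3 + i)) <| .and (.separate i i) (extend k (i + 1))

/-- The vertices `i` and `j` (variables) are adjacent and have the same label in array `0`. -/
def Term.sameAdj (i j : ℕ) : Term := .and (.adj i j) (.eq (.arr 0 i) (.arr 0 j))

/-- The neighbours with the same label of the vertex in variable `0` form a clique. -/
def Term.simplicial : Term :=
  .not <| .sum 3 <| .sum 4 <| .and (.sameAdj 0 3) <| .and (.sameAdj 0 4) <|
    .not (.or (.eq (.var 3) (.var 4)) (.adj 3 4))

/-- The vertex in variable `0` is covered, for the layering in array `1`. -/
def Term.covered : Term :=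
  .sum 3 <| .and (.sameAdj 3 0) <|
    .and (.eq (.add (.arr 1 3) (.lit 1)) (.arr 1 0)) (.dominates 3 0)

/-- The computation of the levels in array `0`. -/
def Cmd.levels (v : ℕ) : Cmd :=
  .each 1 <| .assign 0 <| .ite (.and (.eq (.arr 0 0) (.var 1)) (.extend (v + 1) 0))
    (.add (.var 1) (.lit 1)) (.arr 0 0)

/-- One round of breadth-first search, numbered by variable `2`. -/
def Cmd.layerStep : Cmd :=
  .assign 1 <| .ite (.and (.eq (.arr 1 0) (.lit 0))
    (.sum 3 (.and (.sameAdj 3 0) (.eq (.arr 1 3) (.add (.var 2) (.lit 1))))))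
    (.add (.var 2) (.lit 2)) (.arr 1 0)

/-- The attempt to make the vertex in variable `1` a root. -/
def Cmd.addRoot : Cmd :=
  .assign 1 <| .ite (.and (.eq (.var 0) (.var 1)) (.and (.eq (.arr 1 0) (.lit 0)) .simplicial))
    (.lit 1) (.arr 1 0)

/-- The computation of a layering in array `1`. -/
def Cmd.layers : Cmd := .each 1 (.seq .addRoot (.each 2 .layerStep))

/-- The algorithm with two parts for each level. -/
def Cmd.twoParts (v : ℕ) : Cmd :=
  .seq (.levels v) <| .fill 0 <| .add (.add (.arr 0 0) (.arr 0 0))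
    (.ite (.extend (v - 1) 0) (.lit 1) (.lit 0))

/-- The algorithm with three parts for each level. A vertex that is not covered is put into the
part `0` or `1` according to the parity of its layer, where the quantifier finds half of an even
number. -/
def Cmd.threeParts (v : ℕ) : Cmd :=
  .seq (.levels v) <| .seq .layers <| .fill 0 <|
    .add (.add (.add (.arr 0 0) (.arr 0 0)) (.arr 0 0)) <| .ite .covered (.lit 2) <|
      .ite (.sum 3 (.eq (.add (.var 3) (.var 3)) (.arr 1 0))) (.lit 0) (.lit 1)

theorem Rep.holds_dominates (h : Rep n m G A) {i j : ℕ} {x y : Fin n} (hi : ρ i = x)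
    (hj : ρ j = y) : (Term.dominates j i).Holds n m ρ ↔ Dominates G y x := by
  have key : ∀ u : Fin n,
      (Term.adj i (i + j + 1)).Holds n m (Function.update ρ (i + j + 1) u) ↔ G.Adj x u := fun u =>
    h.holds_adj (by rw [Function.update_of_ne (by omega), hi]) (by simp)
  have key' : ∀ u : Fin n,
      (Term.adj j (i + j + 1)).Holds n m (Function.update ρ (i + j + 1) u) ↔ G.Adj y u := fun u =>
    h.holds_adj (by rw [Function.update_of_ne (by omega), hj]) (by simp)
  have hij : i ≠ i + j + 1 := by omega
  have hji : j ≠ i + j + 1 := by omega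
  simp only [Term.dominates, holds_not, holds_sum, holds_and, holds_or, holds_eq, key, key', eval,
    Function.update_self, Function.update_of_ne hij, Function.update_of_ne hji, hi, hj,
    Fin.val_inj, Dominates]
  push Not
  rfl

theorem Rep.holds_separate (h : Rep n m G A) {i : ℕ} {x : Fin n} (hi : ρ (3 + i) = x)
    {c : ℕ → Fin n} : ∀ {k : ℕ}, (∀ j < k, ρ (3 + j) = c j) →
      ((Term.separate i k).Holds n m ρ ↔ ∀ j < k, c j ≠ x ∧ ¬ G.Adj (c j) x)
  | 0, _ => by simp [Term.separate, Holds, eval]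
  | k + 1, hc => by
    rw [Term.separate, holds_and, h.holds_separate hi fun j hj => hc j (by omega), holds_not,
      holds_or, holds_eq, h.holds_adj (hc k (by omega)) hi]
    simp only [eval, hc k (by omega), hi, Fin.val_inj, not_or]
    exact ⟨fun ⟨h1, h2⟩ j hj => (Nat.lt_succ_iff_lt_or_eq.1 hj).elim (h2 j) fun hjk => hjk ▸ h1,
      fun h1 => ⟨h1 k (by omega), fun j hj => h1 j (by omega)⟩⟩

theorem Rep.holds_extend (h : Rep n m G A) {z : Fin n} (k : ℕ) :
    ∀ (i : ℕ) (ρ : ℕ → ℕ) (c : ℕ → Fin n), ρ 0 = z → (∀ j < i, ρ (3 + j) = c j) →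
      ((Term.extend k i).Holds n m ρ ↔ ∃ W : Finset (Fin n), W.card = k ∧
        (∀ w ∈ W, A 0 z ≤ A 0 w ∧ Dominates G z w) ∧ (∀ w ∈ W, ∀ w' ∈ W, ¬ G.Adj w w') ∧
        ∀ w ∈ W, ∀ j < i, c j ≠ w ∧ ¬ G.Adj (c j) w) := by
  induction k with
  | zero =>
    intro i ρ c _ _
    simp [Term.extend, Holds, eval]
  | succ k ih =>
    intro i ρ c hz hc
    have key : ∀ x : Fin n,
        Function.update ρ (3 + i) (x : ℕ) 0 = z ∧ Function.update ρ (3 + i) (x : ℕ) (3 + i) = x ∧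
        (∀ j < i, Function.update ρ (3 + i) (x : ℕ) (3 + j) = c j) ∧
        ∀ j < i + 1, Function.update ρ (3 + i) (x : ℕ) (3 + j) = Function.update c i x j := by
      intro x
      refine ⟨by rw [Function.update_of_ne (by omega), hz], by simp,
        fun j hj => by rw [Function.update_of_ne (by omega), hc j hj], fun j hj => ?_⟩
      rcases eq_or_ne j i with rfl | hji
      · simp
      · rw [Function.update_of_ne (by omega), Function.update_of_ne hji, hc j (by omega)]
    have : ∀ x : Fin n, _ := fun x => ih (i + 1) _ _ (key x).1 (key x).2.2.2
    rw [Term.extend, holds_sum]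
    simp only [holds_and, holds_le, this, h.eval_arr (key _).1, h.eval_arr (key _).2.1,
      h.holds_dominates (key _).2.1 (key _).1, h.holds_separate (key _).2.1 (key _).2.2.1]
    constructor
    · rintro ⟨x, hx, hdom, hsep, W, hW, h1, h2, h3⟩
      have hxW : ∀ w ∈ W, x ≠ w ∧ ¬ G.Adj x w := fun w hw => by
        simpa using h3 w hw i (by omega)
      have hold : ∀ w ∈ W, ∀ j < i, c j ≠ w ∧ ¬ G.Adj (c j) w := fun w hw j hj => by
        have := h3 w hw j (by omega)
        rwa [Function.update_of_ne (by omega)] at this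
      refine ⟨insert x W, ?_, ?_, ?_, ?_⟩
      · rw [Finset.card_insert_of_notMem fun hx => (hxW x hx).1 rfl, hW]
      · exact Finset.forall_mem_insert _ _ _ |>.2 ⟨⟨hx, hdom⟩, h1⟩
      · simp only [Finset.forall_mem_insert]
        exact ⟨⟨G.loopless.irrefl x, fun w hw => (hxW w hw).2⟩,
          fun w hw => ⟨fun h' => (hxW w hw).2 h'.symm, h2 w hw⟩⟩
      · exact Finset.forall_mem_insert _ _ _ |>.2 ⟨hsep, hold⟩
    · rintro ⟨W, hW, h1, h2, h3⟩
      obtain ⟨x, hx⟩ : W.Nonempty := Finset.card_pos.1 (by omega)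
      refine ⟨x, (h1 x hx).1, (h1 x hx).2, h3 x hx, W.erase x, ?_, ?_, ?_, ?_⟩
      · rw [Finset.card_erase_of_mem hx, hW, Nat.add_sub_cancel]
      · exact fun w hw => h1 w (Finset.mem_of_mem_erase hw)
      · exact fun w hw w' hw' => h2 w (Finset.mem_of_mem_erase hw) w' (Finset.mem_of_mem_erase hw')
      · intro w hw j hj
        rcases eq_or_ne j i with rfl | hji
        · rw [Function.update_self]
          exact ⟨(Finset.ne_of_mem_erase hw).symm, h2 x hx w (Finset.mem_of_mem_erase hw)⟩
        · rw [Function.update_of_ne hji]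
          exact h3 w (Finset.mem_of_mem_erase hw) j (by omega)

theorem Rep.holds_packs (h : Rep n m G A) {z : Fin n} (hz : ρ 0 = z) (k : ℕ) :
    (Term.extend k 0).Holds n m ρ ↔ Packs G (A 0) z k := by
  rw [h.holds_extend k 0 ρ (fun _ => z) hz (by simp), Packs]
  simp

theorem Rep.holds_sameAdj (h : Rep n m G A) {i j : ℕ} {x y : Fin n} (hi : ρ i = x)
    (hj : ρ j = y) : (Term.sameAdj i j).Holds n m ρ ↔ SameAdj G (A 0) x y := by
  rw [Term.sameAdj, holds_and, holds_eq, h.holds_adj hi hj, h.eval_arr hi, h.eval_arr hj, SameAdj]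

theorem Rep.holds_simplicial (h : Rep n m G A) {z : Fin n} (hz : ρ 0 = z) :
    Term.simplicial.Holds n m ρ ↔ SameSimplicial G (A 0) z := by
  have h0 : ∀ x y : Fin n,
      Function.update (Function.update ρ 3 (x : ℕ)) 4 (y : ℕ) 0 = z := fun x y => by simp [hz]
  have h3 : ∀ x y : Fin n,
      Function.update (Function.update ρ 3 (x : ℕ)) 4 (y : ℕ) 3 = x := fun x y => by simp
  have h4 : ∀ x y : Fin n,
      Function.update (Function.update ρ 3 (x : ℕ)) 4 (y : ℕ) 4 = y := fun x y => by simp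
  simp only [Term.simplicial, holds_not, holds_sum, holds_and, holds_or, holds_eq, eval,
    h.holds_sameAdj (h0 _ _) (h3 _ _), h.holds_sameAdj (h0 _ _) (h4 _ _),
    h.holds_adj (h3 _ _) (h4 _ _), h3, h4, Fin.val_inj, SameSimplicial]
  push Not
  rfl

theorem Rep.holds_covered (h : Rep n m G A) {z : Fin n} (hz : ρ 0 = z) :
    Term.covered.Holds n m ρ ↔ IsCovered G (A 0) (A 1) z := by
  have h0 : ∀ x : Fin n, Function.update ρ 3 (x : ℕ) 0 = z := fun x => by simp [hz]
  have h3 : ∀ x : Fin n, Function.update ρ 3 (x : ℕ) 3 = x := fun x => by simp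
  simp only [Term.covered, holds_sum, holds_and, holds_eq, eval, h.holds_sameAdj (h3 _) (h0 _),
    h.eval_arr (h3 _), h.eval_arr (h0 _), h.holds_dominates (h0 _) (h3 _), IsCovered]

theorem rep_levels (G : SimpleGraph (Fin n)) (v : ℕ) :
    ∃ A, Rep n ((Cmd.levels v).run n ρ (input G).mem) G A ∧ A 0 = level G v n ∧
      A 1 = fun _ => 0 := by
  refine run_each_induction (P := fun k m => ∃ A, Rep n m G A ∧ A 0 = level G v k ∧
    A 1 = fun _ => 0) ⟨_, rep_input G, rfl, rfl⟩ ?_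
  rintro k hk m ⟨A, hA, h0, h1⟩
  refine ⟨_, hA.assign (f := level G v (k + 1)) ?_, by simp, by simpa using h1⟩
  intro m' hm' x
  classical
  rw [eval_ite_holds, level]
  simp only [holds_and, holds_eq, eval, hm'.eval_arr (Function.update_self 0 _ _),
    hm'.holds_packs (Function.update_self 0 _ _), h0]
  simp

theorem rep_layers (h : Rep n m G A) (h1 : A 1 = fun _ => 0) :
    ∃ A', Rep n (Cmd.layers.run n ρ m) G A' ∧ A' 0 = A 0 ∧ A' 1 = layers G (A 0) n := by
  classical
  refine run_each_induction (P := fun k m => ∃ A', Rep n m G A' ∧ A' 0 = A 0 ∧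
    A' 1 = layers G (A 0) k) ⟨A, h, rfl, h1⟩ ?_
  rintro k hk m ⟨B, hB, hB0, hB1⟩
  rw [Cmd.run]
  have hroot : Rep n (Cmd.addRoot.run n (Function.update ρ 1 k) m) G
      (Function.update B 1 (addRoot G (A 0) k (layers G (A 0) k))) := by
    refine hB.assign fun m' hm' x => ?_
    rw [eval_ite_holds, _root_.addRoot]
    simp only [holds_and, holds_eq, eval, hm'.eval_arr (Function.update_self 0 _ _),
      hm'.holds_simplicial (Function.update_self 0 _ _), hB0, hB1]
    simp
  refine run_each_induction (P := fun r m => ∃ A', Rep n m G A' ∧ A' 0 = A 0 ∧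
    A' 1 = search G (A 0) (addRoot G (A 0) k (layers G (A 0) k)) r)
    ⟨_, hroot, by simpa using hB0, by simp [search]⟩ ?_
  rintro r hr m ⟨C, hC, hC0, hC1⟩
  refine ⟨_, hC.assign (f := search G (A 0) (addRoot G (A 0) k (layers G (A 0) k)) (r + 1)) ?_,
    by simpa using hC0, by simp⟩
  intro m' hm' x
  have h0 : ∀ y : Fin n, Function.update (Function.update (Function.update
      (Function.update ρ 1 k) 2 r) 0 (x : ℕ)) 3 (y : ℕ) 0 = x := fun y => by simp
  have h3 : ∀ y : Fin n, Function.update (Function.update (Function.update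
      (Function.update ρ 1 k) 2 r) 0 (x : ℕ)) 3 (y : ℕ) 3 = y := fun y => by simp
  rw [eval_ite_holds, search, _root_.layerStep]
  simp only [holds_and, holds_eq, holds_sum, eval, hm'.eval_arr (Function.update_self 0 _ _),
    hm'.holds_sameAdj (h3 _) (h0 _), hm'.eval_arr (h3 _), hC0, hC1]
  simp

/-- The output of the algorithm with two parts for each level. -/
theorem run_twoParts (G : SimpleGraph (Fin n)) (v : ℕ) :
    ∃ b : Fin n → ℕ,
      (∀ z, b z = 0 ∧ ¬ Packs G (level G v n) z (v - 1) ∨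
        b z = 1 ∧ Packs G (level G v n) z (v - 1)) ∧
      ∀ z : Fin n, (Cmd.twoParts v).run n ρ (input G).mem (n * n + z)
        = 2 * level G v n z + b z := by
  classical
  obtain ⟨A, hA, h0, -⟩ := rep_levels (ρ := ρ) G v
  refine ⟨fun z => if Packs G (level G v n) z (v - 1) then 1 else 0, fun z => ?_, ?_⟩
  · by_cases h : Packs G (level G v n) z (v - 1) <;> simp [h]
  · rw [Cmd.twoParts, Cmd.run]
    refine (hA.fill fun m' hm' x => ?_).2
    rw [eval, eval, eval_ite_holds]
    simp only [eval, hm'.eval_arr (Function.update_self 0 _ _),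
      hm'.holds_packs (Function.update_self 0 _ _), h0]
    ring

/-- The output of the algorithm with three parts for each level. -/
theorem run_threeParts (G : SimpleGraph (Fin n)) (v : ℕ) {D : Fin n → ℕ}
    (hD : D = layers G (level G v n) n) (hn : ∀ x, D x ≤ n) :
    ∃ b : Fin n → ℕ,
      (∀ z, IsCovered G (level G v n) D z ∧ b z = 2 ∨
        ¬ IsCovered G (level G v n) D z ∧ b z = D z % 2) ∧
      ∀ z : Fin n, (Cmd.threeParts v).run n ρ (input G).mem (n * n + z)
        = 3 * level G v n z + b z := by
  classical
  obtain ⟨A, hA, h0, h1⟩ := rep_levels (ρ := ρ) G v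
  obtain ⟨B, hB, hB0, hB1⟩ := rep_layers (ρ := ρ) hA h1
  rw [h0] at hB0 hB1
  rw [← hD] at hB1
  refine ⟨fun z => if IsCovered G (level G v n) D z then 2 else D z % 2, fun z => ?_, ?_⟩
  · by_cases h : IsCovered G (level G v n) D z <;> simp [h]
  · rw [Cmd.threeParts, Cmd.run, Cmd.run]
    refine (hB.fill fun m' hm' x => ?_).2
    have hx : ∀ y : Fin n,
        Function.update (Function.update ρ 0 (x : ℕ)) 3 (y : ℕ) 0 = x := fun y => by simp
    have heven : (∃ y : Fin n, (y : ℕ) + y = D x) ↔ D x % 2 = 0 := by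
      refine ⟨fun ⟨y, hy⟩ => by omega, fun h => ?_⟩
      have := hn x
      have := x.pos
      exact ⟨⟨D x / 2, by omega⟩, by simp only; omega⟩
    rw [eval, eval, eval, eval_ite_holds, eval_ite_holds]
    simp only [holds_sum, holds_eq, eval, hm'.eval_arr (Function.update_self 0 _ _),
      hm'.holds_covered (Function.update_self 0 _ _), hm'.eval_arr (hx _), hB0, hB1,
      Function.update_self, heven]
    split_ifs <;> omega

end

/-- A compiled command that outputs a feasible partition of the right size is an approximation
algorithm. -/
theorem isPolyTimeApprox_compile {v ρ : ℕ} (c : Cmd)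
    (hc : ∀ (n : ℕ) (G : SimpleGraph (Fin n)), IsIntervalGraph G → ∀ env : ℕ → ℕ,
      ∃ f : Fin n → ℕ, (∀ z : Fin n, c.run n env (input G).mem (n * n + z) = f z) ∧
        IsClawPartition G v f ∧ numParts f ≤ ρ * minParts G v) :
    IsPolyTimeApprox v ρ (c.compile 0) := by
  obtain ⟨P, hP⟩ := c.compile_spec
  refine ⟨P, fun n G hG => ?_⟩
  obtain ⟨s, ⟨t, ht, hexec⟩, -, hmem⟩ := hP 0 (input G)
  obtain ⟨f, hf, h⟩ := hc n G hG (input G).env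
  have hn : (input G).reg 0 = n := by simp [input]
  rw [hn] at ht hmem
  have : output n s = f := by
    funext z
    rw [output, hmem, hf]
  exact ⟨s, t, hexec, ht, by rwa [this]⟩

end RAM

theorem theorem6 (v : ℕ) (hv : 1 ≤ v) :
    (v ≤ 2 → ∃ p : RAM.Prog, IsPolyTimeApprox v 3 p) ∧
      (3 ≤ v → ∃ p : RAM.Prog, IsPolyTimeApprox v 2 p) := by
  have hlevel : ∀ (n : ℕ) (G : SimpleGraph (Fin n)) (z : Fin n),
      ¬ Packs G (level G v n) z (v + 1) := by
    intro n G z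
    refine not_packs_level ?_
    simpa using level_lt_card_vertices (G := G) hv n z
  refine ⟨fun _ => ⟨_, RAM.isPolyTimeApprox_compile (.threeParts v) fun n G hG env => ?_⟩,
    fun hv3 => ⟨_, RAM.isPolyTimeApprox_compile (.twoParts v) fun n G hG env => ?_⟩⟩
  · obtain ⟨⟨ρ, hD⟩, hn⟩ := exists_isLayering_layers (f := level G v n) hG
    obtain ⟨b, hb, hrun⟩ := RAM.run_threeParts (ρ := env) G v rfl hn
    refine ⟨_, hrun, isClawPartition_three hv hG (hlevel n G) hD hb,
      numParts_le_mul_minParts hv fun z => ?_⟩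
    rcases hb z with h | h <;> omega
  · obtain ⟨b, hb, hrun⟩ := RAM.run_twoParts (ρ := env) G v
    refine ⟨_, hrun, isClawPartition_two hv3 hG (hlevel n G) hb,
      numParts_le_mul_minParts hv fun z => ?_⟩
    rcases hb z with h | h <;> omega
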